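/- Let $G$ be a unimodular, locally compact, second-countable (Hausdorff) group with identity $e$ and Haar measure $m$, and suppose that $G$ is an IN group, i.e. there is a compact neighborhood $Q$ of $e$ with $xQ = Qx$ for all $x \in G$. Let $\sigma \colon G \times G \to \mathbb{T}$ be a continuous 2-cocycle, i.e. $\sigma(x,y)\sigma(xy,z) = \sigma(x,yz)\sigma(y,z)$ for all $x,y,z$ and $\sigma(e,e)=1$. Let $\mathcal{H}$ be a reproducing kernel Hilbert space of complex functions on $G$ with kernel vectors $k_x$ ($f(x) = \langle f, k_x\rangle$ for $f \in \mathcal{H}$), such that (a) $\mathcal{H}$ is isometrically embedded into $L^2(G)$; (b) for all $f \in \mathcal{H}$ and $x \in G$ the function $y \mapsto \sigma(x,x^{-1}y) f(x^{-1}y)$ belongs to $\mathcal{H}$. Let $\Lambda \subseteq G$ be a set of sampling for $\mathcal{H}$, i.e. there are $0 < A \le B < \infty$ with $A\|f\|^2 \le \sum_{\lambda\in\Lambda} |f(\lambda)|^2 \le B\|f\|^2$ for all $f \in \mathcal{H}$. Then $$\|k_e\|^2 \operatorname{covol}_+(\Lambda) \le 1 .$$ If $\mathcal{H} \neq \{0\}$,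 then moreover $\Lambda$ is relatively separated (for some $\ell \in \mathbb{N}$ and some nonempty open $U \subseteq G$, $|\Lambda \cap xU| \le \ell$ for all $x \in G$), so that $\operatorname{covol}_+(\Lambda)$ is defined; if $\mathcal{H} = \{0\}$, the inequality is read as $0 \le 1$. Here $\operatorname{covol}_+(\Lambda)$ is defined as follows for a relatively separated set $\Lambda$. Give the set $\mathcal{C}(G)$ of closed subsets of $G$ the Chabauty--Fell topology, with subbasis $\{C : C \cap K = \emptyset\}$ ($K$ compact) and $\{C : C \cap V \ne \emptyset\}$ ($V$ open). Let $\Omega(\Lambda)$ be the closure of $\{x\Lambda : x \in G\}$ in $\mathcal{C}(G)$, $\Omega^\times(\Lambda) = \Omega(\Lambda) \setminus \{\emptyset\}$ and $\Omega_0(\Lambda) = \{P \in \Omega(\Lambda) : e \in P\}$. For a $G$-invariant Borel probability measure $\mu$ on $\Omega^\times(\Lambda)$ let $\mu_0$ be its transverse measure, the unique measure on $\Omega_0(\Lambda)$ with $$\int_{\Omega^\times(\Lambda)} \sum_{x\in P} F(x,x^{-1}P)\, d\mu(P) = \int_{\Omega_0(\Lambda)} \int_G F(x,Q)\, dm(x)\,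 d\mu_0(Q) \qquad \text{for all } F \in C_c(G\times \Omega_0(\Lambda)),$$ and put $\operatorname{covol}_\mu(\Lambda) = \mu(\Omega^\times(\Lambda))/\mu_0(\Omega_0(\Lambda))$. Then $\operatorname{covol}_+(\Lambda) = \sup_\mu \operatorname{covol}_\mu(\Lambda)$ over all such $\mu$, and $\operatorname{covol}_+(\Lambda) = 0$ if there are none. -/

import Mathlib

open MeasureTheory TopologicalSpace Topology
open scoped Pointwise ENNReal NNReal

namespace HullDensity

section Topology

variable {G : Type*} [TopologicalSpace G]

/-- The set of closed subsets of `G`; a type synonym of `Closeds G`, which will carry the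
Chabauty--Fell topology. -/
def ClosedSubsets (G : Type*) [TopologicalSpace G] : Type _ := Closeds G

instance : SetLike (ClosedSubsets G) G := inferInstanceAs (SetLike (Closeds G) G)

/-- A closed set as an element of `ClosedSubsets G`. -/
def ClosedSubsets.mk (C : Set G) (hC : IsClosed C) : ClosedSubsets G := (⟨C, hC⟩ : Closeds G)

@[simp]
theorem ClosedSubsets.coe_mk (C : Set G) (hC : IsClosed C) :
    (ClosedSubsets.mk C hC : Set G) = C := rfl

theorem ClosedSubsets.isClosed (C : ClosedSubsets G) : IsClosed (C : Set G) :=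
  Closeds.isClosed (α := G) C

/-- The Chabauty--Fell topology: the subbasic open sets are `{C | C ∩ K = ∅}` for `K` compact
and `{C | C ∩ V ≠ ∅}` for `V` open. -/
instance : TopologicalSpace (ClosedSubsets G) :=
  TopologicalSpace.generateFrom
    ({O | ∃ K : Set G, IsCompact K ∧ O = {C : ClosedSubsets G | (C : Set G) ∩ K = ∅}} ∪
      {O | ∃ V : Set G, IsOpen V ∧ O = {C : ClosedSubsets G | ((C : Set G) ∩ V).Nonempty}})

instance : MeasurableSpace (ClosedSubsets G) := borel _

instance : BorelSpace (ClosedSubsets G) := ⟨rfl⟩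

end Topology

section PointSets

variable {G : Type*} [TopologicalSpace G] [Group G]

/-- `Λ` is relatively separated: for some `ℓ ∈ ℕ` and some nonempty open set `U`, every left
translate `xU` contains at most `ℓ` points of `Λ`. -/
def IsRelativelySeparated (Λ : Set G) : Prop :=
  ∃ (l : ℕ) (U : Set G), IsOpen U ∧ U.Nonempty ∧ ∀ x : G, (Λ ∩ x • U).encard ≤ l

variable (G) in
/-- `G` is an IN group: some compact neighborhood `Q` of the identity satisfies `xQ = Qx` for all
`x`. -/
def IsINGroup : Prop :=
  ∃ Q : Set G, IsCompact Q ∧ Q ∈ 𝓝 (1 : G) ∧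
    ∀ x : G, (fun q => x * q) '' Q = (fun q => q * x) '' Q

variable [IsTopologicalGroup G]

/-- The left translate `xC` of a closed set `C`. -/
def translate (x : G) (C : ClosedSubsets G) : ClosedSubsets G :=
  .mk (x • (C : Set G)) (C.isClosed.smul x)

@[simp]
theorem coe_translate (x : G) (C : ClosedSubsets G) :
    (translate x C : Set G) = x • (C : Set G) := rfl

theorem continuous_translate (x : G) : Continuous (translate x : ClosedSubsets G → _) := by
  refine continuous_generateFrom_iff.2 ?_
  rintro O (⟨K, hK, rfl⟩ | ⟨V, hV, rfl⟩)
  · refine isOpen_generateFrom_of_mem (Or.inl ⟨x⁻¹ • K, hK.smul _, ?_⟩)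
    ext C
    have : x • (C : Set G) ∩ K = x • ((C : Set G) ∩ x⁻¹ • K) := by
      rw [Set.smul_set_inter, smul_inv_smul]
    simp [this]
  · refine isOpen_generateFrom_of_mem (Or.inr ⟨x⁻¹ • V, hV.smul _, ?_⟩)
    ext C
    have : x • (C : Set G) ∩ V = x • ((C : Set G) ∩ x⁻¹ • V) := by
      rw [Set.smul_set_inter, smul_inv_smul]
    simp [this]

/-- The hull of `Λ`: the closure of the orbit `{xΛ | x ∈ G}` in the space of closed subsets.
(Relatively separated sets are closed, so `closure Λ = Λ` for them; the closure only makes the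
definition meaningful for every subset.) -/
def hull (Λ : Set G) : Set (ClosedSubsets G) :=
  closure (Set.range fun x : G => translate x (.mk (closure Λ) isClosed_closure))

/-- The punctured hull: the hull without the empty set. -/
def puncturedHull (Λ : Set G) : Set (ClosedSubsets G) :=
  {P ∈ hull Λ | (P : Set G).Nonempty}

/-- The transversal: the elements of the hull that contain the identity. -/
def transversal (Λ : Set G) : Set (ClosedSubsets G) :=
  {P ∈ hull Λ | (1 : G) ∈ P}

theorem translate_mem_hull {Λ : Set G} {P : ClosedSubsets G} (x : G) (hP : P ∈ hull Λ) :
    translate x P ∈ hull Λ := by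
  refine map_mem_closure (continuous_translate x) hP ?_
  rintro _ ⟨y, rfl⟩
  refine ⟨x * y, SetLike.coe_injective ?_⟩
  simp [mul_smul]

/-- The left action of `G` on the punctured hull. -/
def puncturedHullAct {Λ : Set G} (x : G) (P : puncturedHull Λ) : puncturedHull Λ :=
  ⟨translate x P, translate_mem_hull x P.2.1, P.2.2.smul_set⟩

/-- For `P` in the punctured hull and `x ∈ P`, the element `x⁻¹P` of the transversal. -/
def toTransversal {Λ : Set G} (P : puncturedHull Λ) (x : (P : ClosedSubsets G)) :
    transversal Λ :=
  ⟨translate (x : G)⁻¹ P, translate_mem_hull _ P.2.1, by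
    change (1 : G) ∈ (x : G)⁻¹ • ((P : ClosedSubsets G) : Set G)
    exact Set.mem_smul_set.2 ⟨x, x.2, by simp⟩⟩

/-- The `G`-invariant Borel probability measures on the punctured hull. (The punctured hull of a
locally compact second-countable group is locally compact and second countable, so these are
Radon measures.) -/
def invariantProbabilityMeasures (Λ : Set G) : Set (Measure (puncturedHull Λ)) :=
  {μ | IsProbabilityMeasure μ ∧ ∀ x : G, μ.map (puncturedHullAct x) = μ}

variable [MeasurableSpace G]

/-- `μ₀` is a transverse measure of `μ`: for all compactly supported continuous `F` on
`G × transversal Λ`,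
`∫ ∑_{x ∈ P} F (x, x⁻¹P) dμ(P) = ∫ ∫ F (x, Q) dm(x) dμ₀(Q)`.
It is enough to ask for this for nonnegative `F`, and there all integrals make sense. -/
def IsTransverseMeasure (m : Measure G) {Λ : Set G} (μ : Measure (puncturedHull Λ))
    (μ₀ : Measure (transversal Λ)) : Prop :=
  ∀ F : G × transversal Λ → ℝ≥0, Continuous F → HasCompactSupport F →
    ∫⁻ P, ∑' x : (P : ClosedSubsets G), (F (x, toTransversal P x) : ℝ≥0∞) ∂μ =
      ∫⁻ Q, ∫⁻ x, (F (x, Q) : ℝ≥0∞) ∂m ∂μ₀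

open Classical in
/-- The transverse measure of `μ` (for a relatively separated set `Λ` and a finite invariant
measure `μ` there is exactly one; the value is `0` if there is none). -/
noncomputable def transverseMeasure (m : Measure G) {Λ : Set G} (μ : Measure (puncturedHull Λ)) :
    Measure (transversal Λ) :=
  if h : ∃ μ₀, IsTransverseMeasure m μ μ₀ then h.choose else 0

/-- The covolume of `Λ` with respect to `μ`: the total mass of `μ` divided by the total mass of
its transverse measure. -/
noncomputable def covol (m : Measure G) (Λ : Set G) (μ : Measure (puncturedHull Λ)) : ℝ≥0∞ :=
  μ Set.univ / transverseMeasure m μ Set.univ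

/-- The upper covolume: the supremum of the covolumes over all invariant probability measures on
the punctured hull (`0` if there are none). -/
noncomputable def upperCovol (m : Measure G) (Λ : Set G) : ℝ≥0∞ :=
  ⨆ μ ∈ invariantProbabilityMeasures Λ, covol m Λ μ

end PointSets

/-- Continuous 2-cocycles on `G` with values in the unit circle, normalized at the identity. -/
structure IsContinuousTwoCocycle {G : Type*} [TopologicalSpace G] [Group G]
    (σ : G → G → Circle) : Prop where
  continuous : Continuous fun p : G × G => σ p.1 p.2
  cocycle : ∀ x y z : G, σ x y * σ (x * y) z = σ x (y * z) * σ y z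
  map_one_one : σ 1 1 = 1

section RKHS

variable {G : Type*} (H : Type*) [NormedAddCommGroup H] [InnerProductSpace ℂ H] [RKHS ℂ H G ℂ]

/-- The inclusion of `H` into `L²(G, m)` is (well defined and) isometric. -/
def IsIsometricallyInL2 [MeasurableSpace G] (m : Measure G) : Prop :=
  ∀ f : H, MemLp (f : G → ℂ) 2 m ∧ (eLpNorm (f : G → ℂ) 2 m).toReal = ‖f‖

/-- `σ`-twisted invariance: with `f`, also `y ↦ σ(x, x⁻¹y) f(x⁻¹y)` is in `H`, for all `x`. -/
def IsTwistedInvariant [Group G] (σ : G → G → Circle) : Prop :=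
  ∀ (f : H) (x : G), ∃ g : H, ∀ y : G, g y = (σ x (x⁻¹ * y) : ℂ) * f (x⁻¹ * y)

/-- `Λ` is a set of sampling for `H`. -/
def IsSetOfSampling (Λ : Set G) : Prop :=
  ∃ A B : ℝ, 0 < A ∧ A ≤ B ∧ ∀ f : H, Summable (fun l : Λ => ‖f (l : G)‖ ^ 2) ∧
    A * ‖f‖ ^ 2 ≤ ∑' l : Λ, ‖f (l : G)‖ ^ 2 ∧ ∑' l : Λ, ‖f (l : G)‖ ^ 2 ≤ B * ‖f‖ ^ 2

/-- The kernel vector `k_x ∈ H`, characterized by `f x = ⟨f, k_x⟩` for all `f ∈ H`. -/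
noncomputable def kernelVector [CompleteSpace H] (x : G) : H := RKHS.kerFun H x (1 : ℂ)

/-- The reproducing property (Mathlib's inner product is linear in the second variable). -/
theorem inner_kernelVector [CompleteSpace H] (f : H) (x : G) :
    inner ℂ (kernelVector H x) f = f x := by
  simp [kernelVector]

end RKHS

end HullDensity

/-! Fix an invariant probability measure `μ` on the punctured hull and regard it as a random point
set `P`. Its covolume is the reciprocal of the total mass of `μ₀`, and that mass is the intensity of
`P`: `∫ φ dm · μ₀(univ)` is the mean of `∑_{y ∈ P} φ(y)` (`IsTransverseMeasure.lintegral_mul_univ`).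
So the claim is that an invariant random set of sampling has intensity at least `‖k_e‖²`.

Let `C_P` be the analysis operator and `S_P = C_P† C_P` the frame operator. If `S_P` were the
identity, then `∑_{y ∈ P} |⟨k_e, k_y⟩|² = ‖k_e‖²` and `‖k_y‖² ≤ 1`, and averaging would compare the
two. In general `k_y` is replaced by `T_P k_y` with `T_P = h(S_P)`, where the polynomial `h`
approximates `1/√t` on an interval containing all spectra. Then `C_P T_P` is almost isometric
(`abs_norm_sq_aeval_sub_le`), so the sum is at least `(1 - ε)‖k_e‖²`; and `‖T_P k_y‖² ≤ 1 + ε`,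
since `T_P k_y` is the image of a unit vector under the adjoint of `C_P T_P`
(`norm_sq_aeval_adjoint_le`). A polynomial, unlike the square root itself, makes measurability in
`P` and covariance elementary.

The function `Φ(x, P, y) = |⟨k_x, T_P k_y⟩|²` is invariant under the diagonal action, because
twisted translations intertwine `S_P` with `S_{gP}` (`frameOperator_translate`). By
`mass_transport`, where unimodularity enters, the sum over `y` seen from `e` can be traded for the
integral over `x`, which is `‖T_P k_y‖²` since `H` lies isometrically in `L²`. Letting `ε → 0` gives
the bound.

One `h` must serve all `P`, so the frame bounds must be uniform on the hull. The upper bound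
survives limits by lower semicontinuity (`bessel_hull`). For the lower bound
(`exists_lower_bound_hull`), energy could escape to infinity or points could merge. The IN property
makes tails uniformly small for projections of compactly supported functions, which are dense in
`H`; merging costs only a bounded factor. -/

namespace HullDensity

/-! ### The Chabauty--Fell topology: compactness, countability, semicontinuity -/

section FellTopology

variable {G : Type*} [TopologicalSpace G]

theorem isOpen_setOf_inter_eq_empty {K : Set G} (hK : IsCompact K) :
    IsOpen {C : ClosedSubsets G | (C : Set G) ∩ K = ∅} :=
  isOpen_generateFrom_of_mem (Or.inl ⟨K, hK, rfl⟩)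

theorem isOpen_setOf_inter_nonempty {V : Set G} (hV : IsOpen V) :
    IsOpen {C : ClosedSubsets G | ((C : Set G) ∩ V).Nonempty} :=
  isOpen_generateFrom_of_mem (Or.inr ⟨V, hV, rfl⟩)

theorem tendsto_closedSubsets_iff {ι : Type*} {l : Filter ι} {f : ι → ClosedSubsets G}
    {C : ClosedSubsets G} :
    Filter.Tendsto f l (𝓝 C) ↔
      (∀ K, IsCompact K → (C : Set G) ∩ K = ∅ → ∀ᶠ i in l, (f i : Set G) ∩ K = ∅) ∧
      ∀ V, IsOpen V → ((C : Set G) ∩ V).Nonempty → ∀ᶠ i in l, ((f i : Set G) ∩ V).Nonempty := by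
  rw [tendsto_nhds_generateFrom_iff]
  constructor
  · intro h
    exact ⟨fun K hK hC => h _ (Or.inl ⟨K, hK, rfl⟩) hC,
      fun V hV hC => h _ (Or.inr ⟨V, hV, rfl⟩) hC⟩
  · rintro ⟨h₁, h₂⟩ _ (⟨K, hK, rfl⟩ | ⟨V, hV, rfl⟩) hC
    · exact h₁ K hK hC
    · exact h₂ V hV hC

/-- The Chabauty--Fell topology is compact. -/
instance : CompactSpace (ClosedSubsets G) := by
  refine ⟨isCompact_iff_ultrafilter_le_nhds.2 fun 𝓤 _ => ?_⟩
  -- The limit of the ultrafilter: points all of whose neighborhoods are hit by almost every set.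
  let L : Set G := {x | ∀ V, IsOpen V → x ∈ V → ∀ᶠ P : ClosedSubsets G in (𝓤 : Filter _),
    ((P : Set G) ∩ V).Nonempty}
  have hL : IsClosed L := by
    refine isClosed_of_closure_subset fun x hx V hV hxV => ?_
    obtain ⟨y, hyV, hy⟩ := mem_closure_iff.1 hx V hV hxV
    exact hy V hV hyV
  refine ⟨.mk L hL, Set.mem_univ _, ?_⟩
  change Filter.Tendsto id _ _
  refine tendsto_closedSubsets_iff.2 ⟨fun K hK hC => ?_, ?_⟩
  · refine hK.induction_on (p := fun s => ∀ᶠ P : ClosedSubsets G in (𝓤 : Filter _),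
      (P : Set G) ∩ s = ∅) (by simp) (fun s t hst ht => ?_) (fun s t hs ht => ?_) fun x hx => ?_
    · exact ht.mono fun P hP => Set.subset_eq_empty (Set.inter_subset_inter_right _ hst) hP
    · filter_upwards [hs, ht] with P h₁ h₂
      rw [Set.inter_union_distrib_left, h₁, h₂, Set.union_empty]
    · have hxL : x ∉ L := fun h => (Set.eq_empty_iff_forall_notMem.1 hC x) ⟨h, hx⟩
      simp only [L, Set.mem_ofPred_eq, not_forall] at hxL
      obtain ⟨V, hV, hxV, hn⟩ := hxL
      refine ⟨V, mem_nhdsWithin_of_mem_nhds (hV.mem_nhds hxV), ?_⟩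
      exact (Ultrafilter.eventually_not.2 hn).mono fun P hP => Set.not_nonempty_iff_eq_empty.1 hP
  · rintro V hV ⟨x, hx, hxV⟩
    exact hx V hV hxV

/-- By local compactness a compact set disjoint from `C` lies in a finite union of basic open sets
whose compact closure is still disjoint from `C`. Countably many such unions suffice. -/
instance [T2Space G] [LocallyCompactSpace G] [SecondCountableTopology G] :
    SecondCountableTopology (ClosedSubsets G) := by
  obtain ⟨b, hbc, -, hb⟩ := exists_countable_basis G
  let 𝓕 : Set (Set G) := {s | ∃ t ⊆ b, t.Finite ∧ s = ⋃₀ t}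
  have h𝓕 : 𝓕.Countable := by
    have : 𝓕 = (fun t : Set (Set G) => ⋃₀ t) '' {t | t.Finite ∧ t ⊆ b} := by
      ext s; constructor
      · rintro ⟨t, h1, h2, rfl⟩; exact ⟨t, ⟨h2, h1⟩, rfl⟩
      · rintro ⟨t, ⟨h2, h1⟩, rfl⟩; exact ⟨t, h1, h2, rfl⟩
    rw [this]
    exact (Set.countable_ofPred_finite_subset hbc).image _
  let 𝓢 : Set (Set (ClosedSubsets G)) :=
    (fun s => {C : ClosedSubsets G | (C : Set G) ∩ closure s = ∅}) ''
        {s ∈ 𝓕 | IsCompact (closure s)} ∪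
      (fun V => {C : ClosedSubsets G | ((C : Set G) ∩ V).Nonempty}) '' b
  have h𝓢 : 𝓢.Countable := ((h𝓕.mono fun _ h => h.1).image _).union (hbc.image _)
  refine ⟨𝓢, h𝓢, le_antisymm ?_ ?_⟩
  · refine le_generateFrom ?_
    rintro _ (⟨s, hs, rfl⟩ | ⟨V, hV, rfl⟩)
    · exact isOpen_setOf_inter_eq_empty hs.2
    · exact isOpen_setOf_inter_nonempty (hb.isOpen hV)
  · refine le_generateFrom ?_
    rintro _ (⟨K, hK, rfl⟩ | ⟨V, hV, rfl⟩)
    · refine (@isOpen_iff_forall_mem_open _ (generateFrom 𝓢) _).2 fun C hC => ?_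
      have key : ∃ s ∈ 𝓕, K ⊆ s ∧ IsCompact (closure s) ∧ (C : Set G) ∩ closure s = ∅ := by
        refine hK.induction_on (p := fun k => ∃ s ∈ 𝓕, k ⊆ s ∧ IsCompact (closure s) ∧
          (C : Set G) ∩ closure s = ∅) ⟨∅, ⟨∅, by simp⟩, by simp⟩ ?_ ?_ fun x hx => ?_
        · rintro s t hst ⟨u, hu, htu, h⟩
          exact ⟨u, hu, hst.trans htu, h⟩
        · rintro s t ⟨u, ⟨a, hab, ha, rfl⟩, hsu, hu1, hu2⟩ ⟨v, ⟨a', hab', ha', rfl⟩, htv, hv1, hv2⟩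
          refine ⟨⋃₀ (a ∪ a'), ⟨_, Set.union_subset hab hab', ha.union ha', rfl⟩, ?_, ?_, ?_⟩
          · rw [Set.sUnion_union]; exact Set.union_subset_union hsu htv
          · rw [Set.sUnion_union, closure_union]; exact hu1.union hv1
          · rw [Set.sUnion_union, closure_union, Set.inter_union_distrib_left, hu2, hv2,
              Set.union_empty]
        · have hxC : x ∈ (C : Set G)ᶜ := fun h => (Set.eq_empty_iff_forall_notMem.1 hC x) ⟨h, hx⟩
          obtain ⟨k, hk, hxk, hkC⟩ := exists_compact_subset C.isClosed.isOpen_compl hxC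
          obtain ⟨v, hvb, hxv, hvk⟩ := hb.exists_subset_of_mem_open hxk isOpen_interior
          have hvk' : closure v ⊆ k := closure_minimal (hvk.trans interior_subset) hk.isClosed
          refine ⟨v, mem_nhdsWithin_of_mem_nhds ((hb.isOpen hvb).mem_nhds hxv), v,
            ⟨{v}, by simpa, by simp, by simp⟩, subset_rfl, hk.of_isClosed_subset isClosed_closure hvk',
            ?_⟩
          rw [← Set.disjoint_iff_inter_eq_empty]
          exact (Set.disjoint_left.2 fun y hy hyv => hkC (hvk' hyv) hy)
      obtain ⟨s, hs, hKs, hsc, hsC⟩ := key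
      refine ⟨_, ?_, isOpen_generateFrom_of_mem (Or.inl ⟨s, ⟨hs, hsc⟩, rfl⟩), hsC⟩
      exact fun D hD => Set.subset_eq_empty
        (Set.inter_subset_inter_right _ (hKs.trans subset_closure)) hD
    · refine (@isOpen_iff_forall_mem_open _ (generateFrom 𝓢) _).2 ?_
      rintro C ⟨x, hxC, hxV⟩
      obtain ⟨v, hvb, hxv, hvV⟩ := hb.exists_subset_of_mem_open hxV hV
      refine ⟨_, ?_, isOpen_generateFrom_of_mem (Or.inr ⟨v, hvb, rfl⟩), ⟨x, hxC, hxv⟩⟩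
      exact fun D hD => hD.mono (Set.inter_subset_inter_right _ hvV)

theorem isClosed_setOf_mem_closedSubsets [T2Space G] [LocallyCompactSpace G] :
    IsClosed {p : ClosedSubsets G × G | p.2 ∈ p.1} := by
  rw [← isOpen_compl_iff, isOpen_iff_mem_nhds]
  rintro ⟨C, x⟩ hx
  obtain ⟨k, hk, hxk, hkC⟩ := exists_compact_subset C.isClosed.isOpen_compl hx
  have h₁ : {D : ClosedSubsets G | (D : Set G) ∩ k = ∅} ∈ 𝓝 C := by
    refine (isOpen_setOf_inter_eq_empty hk).mem_nhds ?_
    exact Set.disjoint_iff_inter_eq_empty.1 (Set.disjoint_left.2 fun y hy hyv => hkC hyv hy)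
  filter_upwards [prod_mem_nhds h₁ (isOpen_interior.mem_nhds hxk)]
  rintro ⟨D, y⟩ ⟨hD, hy⟩ hyD
  exact Set.eq_empty_iff_forall_notMem.1 hD y ⟨hyD, interior_subset hy⟩

/-- For lower semicontinuous `F ≥ 0`, the sum of `F` over a closed set is a lower semicontinuous
function of the set. -/
theorem lowerSemicontinuous_tsum_closedSubsets [T2Space G] {F : G → ℝ≥0∞}
    (hF : LowerSemicontinuous F) :
    LowerSemicontinuous fun C : ClosedSubsets G => ∑' x : C, F x := by
  intro C a ha
  change a < ∑' x : C, F x at ha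
  rw [ENNReal.tsum_eq_iSup_sum] at ha
  obtain ⟨s, hs⟩ := lt_iSup_iff.1 ha
  obtain ⟨U, hU, hUd⟩ := (s.finite_toSet.image ((↑) : C → G)).t2_separation
  -- A finite minorant of the sum: one supremum over each of the disjoint neighborhoods `U x`. It is
  -- lower semicontinuous because hitting an open set is an open condition.
  let L : ClosedSubsets G → ℝ≥0∞ := fun D => ∑ x ∈ s, ⨆ y ∈ (D : Set G) ∩ U x, F y
  have hL : LowerSemicontinuous L := by
    refine lowerSemicontinuous_sum fun x _ => ?_
    intro D b hb
    simp only [lt_iSup_iff] at hb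
    obtain ⟨y, ⟨hyD, hyU⟩, hy⟩ := hb
    have hO := isOpen_setOf_inter_nonempty (G := G)
      (((hU x).2).inter (hF.isOpen_preimage b))
    filter_upwards [hO.mem_nhds ⟨y, hyD, hyU, hy⟩]
    rintro E ⟨z, hzE, hzU, hz⟩
    exact lt_of_lt_of_le hz (le_iSup₂ (f := fun y (_ : y ∈ (E : Set G) ∩ U x) => F y) z ⟨hzE, hzU⟩)
  have hLC : a < L C := by
    refine hs.trans_le (Finset.sum_le_sum fun x _ => ?_)
    exact le_iSup₂ (f := fun y (_ : y ∈ (C : Set G) ∩ U x) => F y) (x : G) ⟨x.2, (hU x).1⟩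
  filter_upwards [hL C a hLC] with D hD
  refine hD.trans_le ?_
  have h1 : ∀ x ∈ s, (⨆ y ∈ (D : Set G) ∩ U x, F y) ≤ ∑' y : D, (U x).indicator F y := by
    intro x _
    refine iSup₂_le fun y hy => ?_
    calc F y = (U x).indicator F y := by rw [Set.indicator_of_mem hy.2]
      _ ≤ _ := ENNReal.le_tsum (f := fun y : D => (U x).indicator F y) ⟨y, hy.1⟩
  refine (Finset.sum_le_sum h1).trans ?_
  rw [← Summable.tsum_finsetSum fun _ _ => ENNReal.summable]
  refine ENNReal.tsum_le_tsum fun y => ?_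
  by_cases h : ∃ x ∈ s, (y : G) ∈ U x
  · obtain ⟨x, hx, hy⟩ := h
    rw [Finset.sum_eq_single_of_mem x hx]
    · exact Set.indicator_le_self _ _ _
    · intro x' hx' hne
      refine Set.indicator_of_notMem (fun hy' => ?_) _
      exact Set.disjoint_left.1 (hUd ⟨x, hx, rfl⟩ ⟨x', hx', rfl⟩
        (fun h => hne (Subtype.ext h.symm))) hy hy'
  · push Not at h
    rw [Finset.sum_eq_zero fun x hx => Set.indicator_of_notMem (h x hx) _]
    exact zero_le

end FellTopology

/-! ### Joint continuity of translation and compactness of the transversal -/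

section Translation

variable {G : Type*} [TopologicalSpace G] [Group G] [IsTopologicalGroup G]

theorem mem_translate {x y : G} {C : ClosedSubsets G} : y ∈ translate x C ↔ x⁻¹ * y ∈ C := by
  change y ∈ x • (C : Set G) ↔ _
  rw [Set.mem_smul_set_iff_inv_smul_mem]; rfl

theorem translate_translate (x y : G) (C : ClosedSubsets G) :
    translate x (translate y C) = translate (x * y) C :=
  SetLike.coe_injective (by simp [mul_smul])

/-- Translation by `x` as a bijection between the points of `P` and those of `xP`. -/
def translateEquiv (x : G) (P : ClosedSubsets G) : P ≃ translate x P where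
  toFun y := ⟨x * y, mem_translate.2 (by simp)⟩
  invFun y := ⟨x⁻¹ * y, mem_translate.1 y.2⟩
  left_inv y := Subtype.ext (by simp)
  right_inv y := Subtype.ext (by simp)

theorem continuous_uncurry_translate [LocallyCompactSpace G] :
    Continuous fun p : G × ClosedSubsets G => translate p.1 p.2 := by
  refine continuous_generateFrom_iff.2 ?_
  rintro O (⟨K, hK, rfl⟩ | ⟨V, hV, rfl⟩) <;> refine isOpen_iff_mem_nhds.2 ?_
  · rintro ⟨x, C⟩ hC
    have hsub : x⁻¹ • K ⊆ (C : Set G)ᶜ := by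
      intro y hy hyC
      refine Set.eq_empty_iff_forall_notMem.1 hC (x * y) ⟨?_, ?_⟩
      · exact mem_translate.2 (by simpa using hyC)
      · simpa [Set.mem_smul_set_iff_inv_smul_mem] using hy
    obtain ⟨W, hW, hWC⟩ := compact_open_separated_mul_left (hK.smul x⁻¹) C.isClosed.isOpen_compl hsub
    obtain ⟨N, hN, hNW, hNc⟩ := local_compact_nhds hW
    have h1 : (fun y : G => y⁻¹ * x) ⁻¹' N ∈ 𝓝 x :=
      (by fun_prop : ContinuousAt (fun y : G => y⁻¹ * x) x).preimage_mem_nhds (by simpa using hN)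
    have h2 : {D : ClosedSubsets G | (D : Set G) ∩ (N * x⁻¹ • K) = ∅} ∈ 𝓝 C := by
      refine (isOpen_setOf_inter_eq_empty (hNc.mul (hK.smul _))).mem_nhds ?_
      exact Set.disjoint_iff_inter_eq_empty.1 (Set.disjoint_left.2 fun y hy hyv =>
        hWC (Set.mul_subset_mul_right hNW hyv) hy)
    filter_upwards [prod_mem_nhds h1 h2]
    rintro ⟨y, D⟩ ⟨hy, hD⟩
    refine Set.eq_empty_iff_forall_notMem.2 ?_
    rintro z ⟨hz, hzK⟩
    refine Set.eq_empty_iff_forall_notMem.1 hD (y⁻¹ * z) ⟨mem_translate.1 hz, ?_⟩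
    exact ⟨y⁻¹ * x, hy, x⁻¹ * z, Set.smul_mem_smul_set hzK, by simp [mul_assoc]⟩
  · rintro ⟨x, C⟩ ⟨y, hy, hyV⟩
    have h0 : (fun p : G × G => p.1 * p.2) ⁻¹' V ∈ 𝓝 (x, x⁻¹ * y) :=
      continuous_mul.continuousAt.preimage_mem_nhds (by simpa using hV.mem_nhds hyV)
    obtain ⟨N, hN, M, hM, hNM⟩ := mem_nhds_prod_iff.1 h0
    obtain ⟨M', hM', hMo, hyM⟩ := mem_nhds_iff.1 hM
    have h2 : {D : ClosedSubsets G | ((D : Set G) ∩ M').Nonempty} ∈ 𝓝 C :=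
      (isOpen_setOf_inter_nonempty hMo).mem_nhds ⟨_, mem_translate.1 hy, hyM⟩
    filter_upwards [prod_mem_nhds hN h2]
    rintro ⟨z, D⟩ ⟨hz, w, hwD, hw⟩
    refine ⟨z * w, mem_translate.2 (by simpa using hwD), ?_⟩
    exact hNM (Set.mk_mem_prod hz (hM' hw))

theorem isClosed_transversal [T2Space G] [LocallyCompactSpace G] (Λ : Set G) :
    IsClosed (transversal Λ) :=
  isClosed_closure.inter (isClosed_setOf_mem_closedSubsets.preimage (Continuous.prodMk_left (1 : G)))

instance [T2Space G] [LocallyCompactSpace G] (Λ : Set G) : CompactSpace (transversal Λ) :=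
  isCompact_iff_compactSpace.1 (isClosed_transversal Λ).isCompact

end Translation

open ProbabilityTheory

/-! ### Counting measures of closed sets -/

section PointMeasure

variable {G : Type*} [TopologicalSpace G] [MeasurableSpace G]

/-- The counting measure of a closed set. -/
noncomputable def pointMeasure (C : ClosedSubsets G) : Measure G :=
  Measure.sum fun x : C => Measure.dirac (x : G)

theorem lintegral_pointMeasure [MeasurableSingletonClass G] (C : ClosedSubsets G) (f : G → ℝ≥0∞) :
    ∫⁻ x, f x ∂pointMeasure C = ∑' x : C, f x := by
  rw [pointMeasure, lintegral_sum_measure]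
  exact tsum_congr fun x => lintegral_dirac _ _

theorem pointMeasure_apply [MeasurableSingletonClass G] (C : ClosedSubsets G) {s : Set G}
    (hs : MeasurableSet s) : pointMeasure C s = ((C : Set G) ∩ s).encard := by
  rw [← lintegral_indicator_one hs, lintegral_pointMeasure, ← ENNReal.tsum_set_one]
  change ∑' x : (C : Set G), s.indicator 1 (x : G) = _
  rw [tsum_subtype (C : Set G) (s.indicator (1 : G → ℝ≥0∞)),
    tsum_subtype ((C : Set G) ∩ s) fun _ => (1 : ℝ≥0∞), ← Set.indicator_indicator]
  rfl

variable [T2Space G] [BorelSpace G]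

theorem lowerSemicontinuous_lintegral_pointMeasure {F : G → ℝ≥0∞} (hF : LowerSemicontinuous F) :
    LowerSemicontinuous fun C : ClosedSubsets G => ∫⁻ x, F x ∂pointMeasure C := by
  simp_rw [lintegral_pointMeasure]
  exact lowerSemicontinuous_tsum_closedSubsets hF

theorem lowerSemicontinuous_pointMeasure {U : Set G} (hU : IsOpen U) :
    LowerSemicontinuous fun C : ClosedSubsets G => pointMeasure C U := by
  simpa [lintegral_indicator_const hU.measurableSet] using
    lowerSemicontinuous_lintegral_pointMeasure
      (hU.lowerSemicontinuous_indicator (zero_le (a := (1 : ℝ≥0∞))))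

end PointMeasure

/-! ### Uniform local finiteness on the hull -/

section Hull

variable {G : Type*} [TopologicalSpace G] [Group G] [IsTopologicalGroup G]

theorem IsRelativelySeparated.exists_nhds_one {Λ : Set G} (h : IsRelativelySeparated Λ) :
    ∃ (l : ℕ) (U : Set G), IsOpen U ∧ (1 : G) ∈ U ∧ ∀ x : G, (Λ ∩ x • U).encard ≤ l := by
  obtain ⟨l, U, hU, ⟨u, hu⟩, h⟩ := h
  refine ⟨l, u⁻¹ • U, hU.smul _, by simpa [Set.mem_smul_set_iff_inv_smul_mem] using hu, fun x => ?_⟩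
  rw [smul_smul]
  exact h _

theorem IsRelativelySeparated.isClosed [T2Space G] {Λ : Set G} (h : IsRelativelySeparated Λ) :
    IsClosed Λ := by
  obtain ⟨l, U, hU, h1, h⟩ := h.exists_nhds_one
  refine isClosed_of_closure_subset fun x hx => ?_
  have hxU : x ∈ x • U := by simpa [Set.mem_smul_set_iff_inv_smul_mem] using h1
  have hfin : (Λ ∩ x • U).Finite :=
    Set.finite_of_encard_le_coe (h x)
  have hx' : x ∈ closure (Λ ∩ x • U) := by
    rw [Set.inter_comm]
    exact (hU.smul x).inter_closure ⟨hxU, hx⟩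
  rw [hfin.isClosed.closure_eq] at hx'
  exact hx'.1

theorem exists_translate_mem_of_mem_hull {Λ : Set G} (hΛ : IsClosed Λ) {P : ClosedSubsets G}
    (hP : P ∈ hull Λ) {O : Set (ClosedSubsets G)} (hO : IsOpen O) (hPO : P ∈ O) :
    ∃ x : G, translate x (.mk Λ hΛ) ∈ O := by
  obtain ⟨_, hC, x, rfl⟩ := mem_closure_iff.1 hP O hO hPO
  have h : ClosedSubsets.mk (closure Λ) isClosed_closure = .mk Λ hΛ :=
    SetLike.coe_injective hΛ.closure_eq
  exact ⟨x, by simpa only [h] using hC⟩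

/-- The hull is the closure of the orbit, so closed conditions need checking only on translates of
`Λ`. -/
theorem hull_induction {Λ : Set G} (hΛ : IsClosed Λ) {p : ClosedSubsets G → Prop}
    (hp : IsClosed {C | p C}) (h : ∀ x : G, p (translate x (.mk Λ hΛ)))
    {P : ClosedSubsets G} (hP : P ∈ hull Λ) : p P := by
  by_contra hn
  obtain ⟨x, hx⟩ := exists_translate_mem_of_mem_hull hΛ hP hp.isOpen_compl hn
  exact hx (h x)

theorem translate_mk_mem_hull {Λ : Set G} (hΛ : IsClosed Λ) (x : G) :
    translate x (.mk Λ hΛ) ∈ hull Λ := by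
  have h : ClosedSubsets.mk (closure Λ) isClosed_closure = .mk Λ hΛ :=
    SetLike.coe_injective hΛ.closure_eq
  exact subset_closure ⟨x, by simp only [h]⟩

theorem measurable_puncturedHullAct {Λ : Set G} (x : G) :
    Measurable (puncturedHullAct x : puncturedHull Λ → puncturedHull Λ) :=
  (((continuous_translate x).comp continuous_subtype_val).subtype_mk _).measurable

variable [MeasurableSpace G] [BorelSpace G] [T2Space G]

/-- Counting in an open set is lower semicontinuous, so an upper bound on it is a closed condition.
-/
theorem pointMeasure_smul_le {Λ : Set G} (hΛ : IsClosed Λ) {l : ℕ} {U : Set G} (hU : IsOpen U)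
    (h : ∀ x : G, (Λ ∩ x • U).encard ≤ l) {P : ClosedSubsets G} (hP : P ∈ hull Λ) (x : G) :
    pointMeasure P (x • U) ≤ l := by
  refine hull_induction hΛ (p := fun P => pointMeasure P (x • U) ≤ l) ?_ (fun y => ?_) hP
  · exact (lowerSemicontinuous_pointMeasure (hU.smul x)).isClosed_preimage l
  · rw [pointMeasure_apply _ (hU.smul x).measurableSet, coe_translate, ClosedSubsets.coe_mk]
    have : y • Λ ∩ x • U = y • (Λ ∩ (y⁻¹ * x) • U) := by
      rw [Set.smul_set_inter, smul_smul, mul_inv_cancel_left]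
    rw [this, Set.encard_smul_set]
    exact_mod_cast h (y⁻¹ * x)

theorem exists_pointMeasure_smul_le {Λ : Set G} (hΛ : IsRelativelySeparated Λ) {K : Set G}
    (hK : IsCompact K) : ∃ N : ℕ, ∀ P ∈ hull Λ, ∀ y : G, pointMeasure P (y • K) ≤ N := by
  obtain ⟨l, U, hU, h1, h⟩ := hΛ.exists_nhds_one
  refine hK.induction_on (p := fun s => ∃ N : ℕ, ∀ P ∈ hull Λ, ∀ y : G, pointMeasure P (y • s) ≤ N)
    ⟨0, by simp⟩ ?_ ?_ fun x _ => ?_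
  · rintro s t hst ⟨N, hN⟩
    exact ⟨N, fun P hP y => (measure_mono (Set.smul_set_mono hst)).trans (hN P hP y)⟩
  · rintro s t ⟨N, hN⟩ ⟨M, hM⟩
    refine ⟨N + M, fun P hP y => ?_⟩
    rw [Set.smul_set_union]
    refine (measure_union_le _ _).trans ?_
    push_cast
    exact add_le_add (hN P hP y) (hM P hP y)
  · refine ⟨x • U, mem_nhdsWithin_of_mem_nhds ((hU.smul x).mem_nhds ?_), l, fun P hP y => ?_⟩
    · simpa [Set.mem_smul_set_iff_inv_smul_mem] using h1
    · rw [smul_smul]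
      exact pointMeasure_smul_le hΛ.isClosed hU h hP _

theorem exists_pointMeasure_le {Λ : Set G} (hΛ : IsRelativelySeparated Λ) {K : Set G}
    (hK : IsCompact K) : ∃ N : ℕ, ∀ P ∈ hull Λ, pointMeasure P K ≤ N := by
  obtain ⟨N, hN⟩ := exists_pointMeasure_smul_le hΛ hK
  exact ⟨N, fun P hP => by simpa using hN P hP 1⟩

theorem isFiniteMeasureOnCompacts_pointMeasure {Λ : Set G} (hΛ : IsRelativelySeparated Λ)
    {P : ClosedSubsets G} (hP : P ∈ hull Λ) : IsFiniteMeasureOnCompacts (pointMeasure P) := by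
  refine ⟨fun K hK => ?_⟩
  obtain ⟨N, hN⟩ := exists_pointMeasure_le hΛ hK
  exact (hN P hP).trans_lt (ENNReal.natCast_lt_top N)

/-- In an IN group, the number of `x ∈ P` with `xz ∈ S` is bounded uniformly in `z` and in `P` in
the hull. -/
theorem exists_pointMeasure_preimage_mul_right_le (hIN : IsINGroup G) {Λ : Set G}
    (hΛ : IsRelativelySeparated Λ) {S : Set G} (hS : IsCompact S) :
    ∃ N : ℕ, ∀ P ∈ hull Λ, ∀ z : G, pointMeasure P ((fun x => x * z) ⁻¹' S) ≤ N := by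
  obtain ⟨Q, hQ, hQ1, hQx⟩ := hIN
  obtain ⟨N₀, hN₀⟩ := exists_pointMeasure_smul_le hΛ hQ
  refine hS.induction_on (p := fun s => ∃ N : ℕ, ∀ P ∈ hull Λ, ∀ z : G,
    pointMeasure P ((fun x => x * z) ⁻¹' s) ≤ N) ⟨0, by simp⟩ ?_ ?_ fun x _ => ?_
  · rintro s t hst ⟨N, hN⟩
    exact ⟨N, fun P hP y => (measure_mono (Set.preimage_mono hst)).trans (hN P hP y)⟩
  · rintro s t ⟨N, hN⟩ ⟨M, hM⟩
    refine ⟨N + M, fun P hP y => ?_⟩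
    rw [Set.preimage_union]
    refine (measure_union_le _ _).trans ?_
    push_cast
    exact add_le_add (hN P hP y) (hM P hP y)
  -- Here the IN property acts: the preimage of `xQ` is `xQz⁻¹ = (xz⁻¹)Q`, a left translate of `Q`,
  -- on which counts are uniformly bounded.
  · have hx : x • Q ∈ 𝓝 x := by simpa using smul_mem_nhds_smul x hQ1
    refine ⟨x • Q, mem_nhdsWithin_of_mem_nhds hx, N₀, fun P hP z => ?_⟩
    refine (measure_mono ?_).trans (hN₀ P hP (x * z⁻¹))
    rintro y ⟨q, hq, hqy⟩
    obtain ⟨q', hq', h⟩ : q * z⁻¹ ∈ (fun q => z⁻¹ * q) '' Q := hQx z⁻¹ ▸ ⟨q, hq, rfl⟩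
    refine ⟨q', hq', ?_⟩
    simp only [smul_eq_mul] at h hqy ⊢
    rw [mul_assoc, h, ← mul_assoc, hqy, mul_inv_cancel_right]

theorem lintegral_pointMeasure_translate (x : G) (P : ClosedSubsets G) (f : G → ℝ≥0∞) :
    ∫⁻ y, f y ∂pointMeasure (translate x P) = ∫⁻ y, f (x * y) ∂pointMeasure P := by
  rw [lintegral_pointMeasure, lintegral_pointMeasure]
  exact ((translateEquiv x P).tsum_eq fun y : translate x P => f y).symm

variable [LocallyCompactSpace G] [SecondCountableTopology G]

/-- On each set of a compact exhaustion the measures are finite, so measurability on the π-system of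
open sets, given by semicontinuity, extends to all Borel sets. -/
theorem measurable_pointMeasure {Λ : Set G} (hΛ : IsRelativelySeparated Λ) :
    Measurable fun P : puncturedHull Λ => pointMeasure (P : ClosedSubsets G) := by
  let K : CompactExhaustion G := default
  have hKo : ∀ n, MeasurableSet (interior (K n)) := fun n => isOpen_interior.measurableSet
  have hU : ⋃ n, interior (K n) = Set.univ := by
    refine Set.eq_univ_of_forall fun x => ?_
    obtain ⟨n, hn⟩ := K.exists_mem x
    exact Set.mem_iUnion.2 ⟨n + 1, K.subset_interior_succ n hn⟩
  have hn : ∀ n, Measurable fun P : puncturedHull Λ =>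
      (pointMeasure (P : ClosedSubsets G)).restrict (interior (K n)) := by
    intro n
    have : ∀ P : puncturedHull Λ, IsFiniteMeasure
        ((pointMeasure (P : ClosedSubsets G)).restrict (interior (K n))) := fun P => by
      obtain ⟨N, hN⟩ := exists_pointMeasure_le hΛ (K.isCompact n)
      refine ⟨?_⟩
      rw [Measure.restrict_apply_univ]
      exact ((measure_mono interior_subset).trans (hN P P.2.1)).trans_lt (ENNReal.natCast_lt_top N)
    have ho : ∀ U : Set G, IsOpen U → Measurable fun P : puncturedHull Λ =>
        (pointMeasure (P : ClosedSubsets G)).restrict (interior (K n)) U := fun U hU => by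
      simp_rw [Measure.restrict_apply hU.measurableSet]
      exact (lowerSemicontinuous_pointMeasure (hU.inter isOpen_interior)).measurable.comp
        measurable_subtype_coe
    exact Measurable.measure_of_isPiSystem (BorelSpace.measurable_eq (α := G)) isPiSystem_isOpen
      (fun U hU => ho U hU) (ho _ isOpen_univ)
  refine Measure.measurable_of_measurable_coe _ fun s hs => ?_
  have hs' : ∀ P : puncturedHull Λ, pointMeasure (P : ClosedSubsets G) s =
      ⨆ n, (pointMeasure (P : ClosedSubsets G)).restrict (interior (K n)) s := by
    intro P
    simp_rw [Measure.restrict_apply hs]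
    rw [← Monotone.measure_iUnion, ← Set.inter_iUnion, hU, Set.inter_univ]
    exact fun i j hij => Set.inter_subset_inter_right _ (interior_mono (K.subset hij))
  simp_rw [hs']
  exact Measurable.iSup fun n => (Measure.measurable_coe hs).comp (hn n)

/-- The kernel that sends an element of the punctured hull to its counting measure. -/
noncomputable def pointKernel {Λ : Set G} (hΛ : IsRelativelySeparated Λ) :
    Kernel (puncturedHull Λ) G :=
  ⟨fun P => pointMeasure (P : ClosedSubsets G), measurable_pointMeasure hΛ⟩

instance {Λ : Set G} (hΛ : IsRelativelySeparated Λ) : IsSFiniteKernel (pointKernel hΛ) := by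
  let K : CompactExhaustion G := default
  have hD : ∀ n, MeasurableSet (disjointed K n) := fun n =>
    MeasurableSet.disjointed (fun i => (K.isCompact i).measurableSet) n
  refine ⟨fun n => (pointKernel hΛ).restrict (hD n), fun n => ?_, ?_⟩
  · obtain ⟨N, hN⟩ := exists_pointMeasure_le hΛ (K.isCompact n)
    refine ⟨N, ENNReal.natCast_lt_top N, fun P => ?_⟩
    rw [Kernel.restrict_apply, Measure.restrict_apply_univ]
    exact (measure_mono (disjointed_subset _ n)).trans (hN P P.2.1)
  · ext P : 1
    simp_rw [Kernel.sum_apply, Kernel.restrict_apply]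
    rw [← Measure.restrict_iUnion (disjoint_disjointed _) hD, iUnion_disjointed, K.iUnion_eq,
      Measure.restrict_univ]

theorem measurable_lintegral_pointMeasure {Λ : Set G} (hΛ : IsRelativelySeparated Λ)
    {f : puncturedHull Λ × G → ℝ≥0∞} (hf : Measurable f) :
    Measurable fun P : puncturedHull Λ => ∫⁻ x, f (P, x) ∂pointMeasure (P : ClosedSubsets G) :=
  hf.lintegral_kernel_prod_right' (κ := pointKernel hΛ)

/-- Invariance of the Campbell measure of an invariant measure on the punctured hull. -/
theorem lintegral_lintegral_pointMeasure_act {Λ : Set G} (hΛ : IsRelativelySeparated Λ)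
    {μ : Measure (puncturedHull Λ)} (hμ : ∀ x : G, μ.map (puncturedHullAct x) = μ)
    {f : puncturedHull Λ × G → ℝ≥0∞} (hf : Measurable f) (g : G) :
    ∫⁻ P, ∫⁻ x, f (puncturedHullAct g P, g * x) ∂pointMeasure (P : ClosedSubsets G) ∂μ =
      ∫⁻ P, ∫⁻ x, f (P, x) ∂pointMeasure (P : ClosedSubsets G) ∂μ := by
  nth_rw 2 [← hμ g]
  rw [lintegral_map (measurable_lintegral_pointMeasure hΛ hf) (measurable_puncturedHullAct g)]
  refine lintegral_congr fun P => ?_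
  exact (lintegral_pointMeasure_translate g P fun y => f (puncturedHullAct g P, y)).symm

end Hull

/-! ### Existence of the transverse measure -/

section TransverseMeasure

variable {G : Type*} [TopologicalSpace G] [Group G] [IsTopologicalGroup G]

open Classical in
/-- The map `(P, x) ↦ x⁻¹P`, extended by the constant `Q₀` to the pairs with `x ∉ P`. -/
noncomputable def pointedToTransversal {Λ : Set G} (Q₀ : transversal Λ)
    (p : puncturedHull Λ × G) : transversal Λ :=
  if h : p.2 ∈ (p.1 : ClosedSubsets G) then toTransversal p.1 ⟨p.2, h⟩ else Q₀

theorem pointedToTransversal_coe {Λ : Set G} (Q₀ : transversal Λ) (P : puncturedHull Λ)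
    (x : (P : ClosedSubsets G)) : pointedToTransversal Q₀ (P, (x : G)) = toTransversal P x :=
  dif_pos x.2

/-- Because `(gx)⁻¹(gP) = x⁻¹P`. Hence translation acts only on the first coordinate of `(x, x⁻¹P)`.
-/
theorem pointedToTransversal_act {Λ : Set G} (Q₀ : transversal Λ) (g : G) (P : puncturedHull Λ)
    (x : G) : pointedToTransversal Q₀ (puncturedHullAct g P, g * x) =
      pointedToTransversal Q₀ (P, x) := by
  have hmem : g * x ∈ ((puncturedHullAct g P : puncturedHull Λ) : ClosedSubsets G) ↔
      x ∈ (P : ClosedSubsets G) := by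
    change g * x ∈ translate g (P : ClosedSubsets G) ↔ _
    rw [mem_translate, inv_mul_cancel_left]
  by_cases h : x ∈ (P : ClosedSubsets G)
  · rw [pointedToTransversal_coe Q₀ P ⟨x, h⟩,
      pointedToTransversal_coe Q₀ (puncturedHullAct g P) ⟨g * x, hmem.2 h⟩]
    refine Subtype.ext ?_
    change translate (g * x)⁻¹ (translate g (P : ClosedSubsets G)) = translate x⁻¹ _
    rw [translate_translate]
    simp
  · rw [pointedToTransversal, pointedToTransversal, dif_neg (by exact fun h' => h (hmem.1 h')),
      dif_neg (by exact h)]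

variable [MeasurableSpace G] [BorelSpace G] [T2Space G] [LocallyCompactSpace G]
  [SecondCountableTopology G]

theorem measurable_pointedToTransversal {Λ : Set G} (Q₀ : transversal Λ) :
    Measurable (pointedToTransversal Q₀) := by
  classical
  have hs : IsClosed {p : puncturedHull Λ × G | p.2 ∈ (p.1 : ClosedSubsets G)} :=
    isClosed_setOf_mem_closedSubsets.preimage
      (f := fun p : puncturedHull Λ × G => ((p.1 : ClosedSubsets G), p.2)) (by fun_prop)
  have hc : Continuous fun p : {p : puncturedHull Λ × G | p.2 ∈ (p.1 : ClosedSubsets G)} =>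
      toTransversal p.1.1 ⟨p.1.2, p.2⟩ := by
    refine Continuous.subtype_mk (continuous_uncurry_translate.comp (f := fun
      p : {p : puncturedHull Λ × G | p.2 ∈ (p.1 : ClosedSubsets G)} =>
        ((p.1.2)⁻¹, (p.1.1 : ClosedSubsets G))) (by fun_prop)) _
  have := Measurable.dite hc.measurable (measurable_const (a := Q₀)) hs.measurableSet
  convert this using 1
  ext1 p
  rfl

/-- Every invariant probability measure on the punctured hull of a relatively separated set has a
transverse measure. -/
theorem exists_isTransverseMeasure (m : Measure G) [m.IsHaarMeasure] {Λ : Set G}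
    (hΛ : IsRelativelySeparated Λ) {μ : Measure (puncturedHull Λ)} [IsProbabilityMeasure μ]
    (hμ : ∀ x : G, μ.map (puncturedHullAct x) = μ) :
    ∃ μ₀ : Measure (transversal Λ), IsTransverseMeasure m μ μ₀ := by
  obtain ⟨P₀⟩ := nonempty_of_isProbabilityMeasure μ
  obtain ⟨x₀, hx₀⟩ := P₀.2.2
  let Q₀ : transversal Λ := toTransversal P₀ ⟨x₀, hx₀⟩
  let τ := pointedToTransversal Q₀
  have hτ : Measurable τ := measurable_pointedToTransversal Q₀
  have hpair : Measurable fun p : puncturedHull Λ × G => (p.2, τ p) := measurable_snd.prodMk hτ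
  -- The Campbell measure in the coordinates `(x, x⁻¹P)`. It is left invariant in `x`, so uniqueness
  -- of Haar measure, applied to each slice `νB`, makes it a product `m × μ₀`.
  let ν : Measure (G × transversal Λ) :=
    (μ ⊗ₘ pointKernel hΛ).map fun p : puncturedHull Λ × G => (p.2, τ p)
  have hν : ∀ F : G × transversal Λ → ℝ≥0∞, Measurable F → ∫⁻ p, F p ∂ν =
      ∫⁻ P, ∫⁻ x, F (x, τ (P, x)) ∂pointMeasure (P : ClosedSubsets G) ∂μ := fun F hF => by
    rw [lintegral_map hF hpair]
    exact Measure.lintegral_compProd (hF.comp hpair)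
  have hinv : ∀ F : G × transversal Λ → ℝ≥0∞, Measurable F → ∀ g : G,
      ∫⁻ p, F (g * p.1, p.2) ∂ν = ∫⁻ p, F p ∂ν := fun F hF g => by
    have hF' : Measurable fun p : G × transversal Λ => F (g * p.1, p.2) := hF.comp (by fun_prop)
    rw [hν F hF, hν _ hF']
    refine Eq.trans ?_ (lintegral_lintegral_pointMeasure_act hΛ hμ (hF.comp hpair) g)
    simp only [Function.comp_apply, τ, pointedToTransversal_act]
  have hK : ∀ K : Set G, IsCompact K → ν (K ×ˢ Set.univ) < ∞ := fun K hK => by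
    obtain ⟨N, hN⟩ := exists_pointMeasure_le hΛ hK
    rw [← lintegral_indicator_one (hK.measurableSet.prod .univ),
      hν _ (measurable_one.indicator (hK.measurableSet.prod .univ))]
    calc _ ≤ ∫⁻ P : puncturedHull Λ, (N : ℝ≥0∞) ∂μ := by
          refine lintegral_mono fun P => ?_
          refine le_trans (le_of_eq ?_) (hN P P.2.1)
          rw [← lintegral_indicator_one hK.measurableSet]
          refine lintegral_congr fun x => ?_
          by_cases hx : x ∈ K <;> simp [hx]
      _ < ∞ := by simp
  let νB : Set (transversal Λ) → Measure G := fun B => (ν.restrict (Set.univ ×ˢ B)).map Prod.fst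
  have hνB : ∀ B, MeasurableSet B → ∀ s, MeasurableSet s → νB B s = ν (s ×ˢ B) := by
    intro B hB s hs
    rw [Measure.map_apply measurable_fst hs, Measure.restrict_apply (measurable_fst hs)]
    congr 1
    ext ⟨x, Q⟩; simp
  have hfin : ∀ B, MeasurableSet B → IsFiniteMeasureOnCompacts (νB B) := fun B hB => ⟨fun K hK' => by
    rw [hνB B hB K hK'.measurableSet]
    exact (measure_mono (Set.prod_mono subset_rfl (Set.subset_univ _))).trans_lt (hK K hK')⟩
  have hleft : ∀ B, MeasurableSet B → (νB B).IsMulLeftInvariant := fun B hB => ⟨fun g => by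
    ext s hs
    rw [Measure.map_apply (by fun_prop) hs, hνB B hB _ (measurable_const_mul g hs), hνB B hB s hs,
      ← lintegral_indicator_one (hs.prod hB),
      ← lintegral_indicator_one ((measurable_const_mul g hs).prod hB),
      ← hinv _ (measurable_one.indicator (hs.prod hB)) g]
    exact lintegral_congr fun p => rfl⟩
  obtain ⟨K, hKc, hK1⟩ := exists_compact_mem_nhds (1 : G)
  have hmK : m K ≠ 0 := (MeasureTheory.Measure.measure_pos_of_mem_nhds m hK1).ne'
  have hmK' : m K ≠ ∞ := hKc.measure_lt_top.ne
  let μ₀ : Measure (transversal Λ) := (m K)⁻¹ • (ν.restrict (K ×ˢ Set.univ)).map Prod.snd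
  have hμ₀ : ∀ B, MeasurableSet B → μ₀ B = (m K)⁻¹ * ν (K ×ˢ B) := fun B hB => by
    rw [Measure.smul_apply, Measure.map_apply measurable_snd hB,
      Measure.restrict_apply (measurable_snd hB), smul_eq_mul]
    congr 2
    ext ⟨x, Q⟩; simp [and_comm]
  have : IsFiniteMeasure μ₀ := ⟨by
    rw [hμ₀ _ .univ]
    exact ENNReal.mul_lt_top (ENNReal.inv_lt_top.2 (pos_iff_ne_zero.2 hmK)) (hK K hKc)⟩
  have hprod : m.prod μ₀ = ν := Measure.prod_eq fun s B hs hB => by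
    have := hfin B hB
    have := hleft B hB
    have key := measure_mul_measure_eq (νB B) m K s hmK hmK'
    rw [hνB B hB K hKc.measurableSet, hνB B hB s hs] at key
    rw [hμ₀ B hB, mul_left_comm, mul_comm (m s), key, ← mul_assoc,
      ENNReal.inv_mul_cancel hmK hmK', one_mul]
  refine ⟨μ₀, fun F hF _ => ?_⟩
  have hF' : Measurable fun p : G × transversal Λ => (F p : ℝ≥0∞) := hF.measurable.coe_nnreal_ennreal
  have h1 := hν _ hF'
  rw [← hprod, lintegral_prod_symm _ hF'.aemeasurable] at h1
  rw [h1]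
  refine lintegral_congr fun P => ?_
  rw [lintegral_pointMeasure]
  exact tsum_congr fun x => by rw [← pointedToTransversal_coe Q₀ P x]

/-- Identifies the mass of `μ₀` with the intensity. A test function that depends on `x` alone is
admissible because the transversal is compact. -/
theorem IsTransverseMeasure.lintegral_mul_univ {m : Measure G} {Λ : Set G}
    {μ : Measure (puncturedHull Λ)} {μ₀ : Measure (transversal Λ)}
    (h : IsTransverseMeasure m μ μ₀) {φ : G → ℝ≥0} (hφ : Continuous φ) (hc : HasCompactSupport φ) :
    (∫⁻ x, φ x ∂m) * μ₀ Set.univ =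
      ∫⁻ P, ∫⁻ x, φ x ∂pointMeasure (P : ClosedSubsets G) ∂μ := by
  have := h (fun p => φ p.1) (hφ.comp continuous_fst) ?_
  · dsimp only at this
    rw [lintegral_const] at this
    rw [← this]
    simp_rw [lintegral_pointMeasure]
  · refine IsCompact.of_isClosed_subset (IsCompact.prod hc isCompact_univ) (isClosed_tsupport _)
      (closure_minimal ?_ ((isClosed_tsupport φ).prod isClosed_univ))
    exact fun p hp => ⟨subset_tsupport φ hp, trivial⟩

end TransverseMeasure

/-! ### Twisted translations and covariance of the kernel -/

section TwistedRKHS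

open scoped ComplexConjugate

variable {G : Type*} {H : Type*} [NormedAddCommGroup H] [InnerProductSpace ℂ H] [RKHS ℂ H G ℂ]

/-- The isometric inclusion of `H` into `L²(G, m)`. -/
noncomputable def toL2 [MeasurableSpace G] {m : Measure G} (hL2 : IsIsometricallyInL2 H m) :
    H →ₗᵢ[ℂ] Lp ℂ 2 m where
  toFun f := (hL2 f).1.toLp f
  map_add' f g := by
    rw [← MemLp.toLp_add (hL2 f).1 (hL2 g).1]
    exact MemLp.toLp_congr _ _ (by rw [RKHS.coe_add])
  map_smul' c f := by
    rw [RingHom.id_apply, ← MemLp.toLp_const_smul c (hL2 f).1]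
    exact MemLp.toLp_congr _ _ (by rw [RKHS.coe_smul])
  norm_map' f := by
    change ‖(hL2 f).1.toLp f‖ = _
    rw [Lp.norm_toLp, (hL2 f).2]

theorem toL2_apply [MeasurableSpace G] {m : Measure G} (hL2 : IsIsometricallyInL2 H m) (f : H) :
    toL2 hL2 f = (hL2 f).1.toLp f := rfl

theorem lintegral_enorm_sq_eq [MeasurableSpace G] {m : Measure G} (hL2 : IsIsometricallyInL2 H m)
    (f : H) : ∫⁻ x, ‖f x‖ₑ ^ 2 ∂m = ‖f‖ₑ ^ 2 := by
  have h : eLpNorm f 2 m = ‖f‖ₑ := by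
    rw [← ofReal_norm, ← (hL2 f).2, ENNReal.ofReal_toReal (hL2 f).1.2.ne]
  rw [← h, eLpNorm_eq_lintegral_rpow_enorm_toReal (by simp) (by simp)]
  simp only [ENNReal.toReal_ofNat, ENNReal.rpow_ofNat, one_div]
  rw [← ENNReal.rpow_natCast, ← ENNReal.rpow_mul]
  norm_num

theorem inner_kernelVector' [CompleteSpace H] (f : H) (x : G) :
    inner ℂ f (kernelVector H x) = conj (f x) := by
  rw [← inner_conj_symm, inner_kernelVector]

theorem norm_apply_le [CompleteSpace H] (f : H) (x : G) : ‖f x‖ ≤ ‖kernelVector H x‖ * ‖f‖ := by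
  rw [← inner_kernelVector]
  exact norm_inner_le_norm _ _

variable [Group G] [TopologicalSpace G] [IsTopologicalGroup G] [MeasurableSpace G] [BorelSpace G]
  {m : Measure G} [m.IsMulLeftInvariant] {σ : G → G → Circle}

/-- The twisted left translation on `H`. -/
noncomputable def twistedTranslate (hL2 : IsIsometricallyInL2 H m) (hinv : IsTwistedInvariant H σ)
    (g : G) : H →ₗᵢ[ℂ] H where
  toFun f := (hinv f g).choose
  map_add' f₁ f₂ := by
    ext y
    rw [RKHS.coe_add (hinv f₁ g).choose, Pi.add_apply, (hinv (f₁ + f₂) g).choose_spec,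
      (hinv f₁ g).choose_spec, (hinv f₂ g).choose_spec, RKHS.coe_add, Pi.add_apply, mul_add]
  map_smul' c f := by
    ext y
    rw [RingHom.id_apply, RKHS.coe_smul (hinv f g).choose, Pi.smul_apply,
      (hinv (c • f) g).choose_spec,
      (hinv f g).choose_spec, RKHS.coe_smul, Pi.smul_apply, smul_eq_mul, smul_eq_mul, mul_left_comm]
  norm_map' f := by
    change ‖(hinv f g).choose‖ = ‖f‖
    rw [← (hL2 _).2, ← (hL2 f).2]
    congr 1
    rw [← eLpNorm_comp_measurePreserving (hL2 f).1.1 (measurePreserving_mul_left m g⁻¹)]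
    refine eLpNorm_congr_norm_ae (ae_of_all _ fun y => ?_)
    rw [(hinv f g).choose_spec, norm_mul, Circle.norm_coe, one_mul]
    rfl

theorem twistedTranslate_apply (hL2 : IsIsometricallyInL2 H m) (hinv : IsTwistedInvariant H σ)
    (g : G) (f : H) (y : G) :
    twistedTranslate hL2 hinv g f y = (σ g (g⁻¹ * y) : ℂ) * f (g⁻¹ * y) :=
  (hinv f g).choose_spec y

theorem twistedTranslate_apply_mul (hL2 : IsIsometricallyInL2 H m) (hinv : IsTwistedInvariant H σ)
    (g : G) (f : H) (x : G) :
    twistedTranslate hL2 hinv g f (g * x) = (σ g x : ℂ) * f x := by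
  rw [twistedTranslate_apply, inv_mul_cancel_left]

variable [CompleteSpace H]

theorem adjoint_twistedTranslate_kernelVector (hL2 : IsIsometricallyInL2 H m)
    (hinv : IsTwistedInvariant H σ) (g x : G) :
    (twistedTranslate hL2 hinv g).toContinuousLinearMap.adjoint (kernelVector H (g * x)) =
      conj (σ g x : ℂ) • kernelVector H x := by
  refine ext_inner_right ℂ fun f => ?_
  rw [ContinuousLinearMap.adjoint_inner_left, inner_kernelVector, inner_smul_left,
    inner_kernelVector, Complex.conj_conj]
  exact twistedTranslate_apply_mul hL2 hinv g f x

include m σ in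
-- The adjoint of an isometry is a contraction and takes `k_{gx}` to a unimodular multiple of `k_x`.
-- Thus `‖k_x‖ ≤ ‖k_{gx}‖` for all `g` and `x`, which forces equality.
theorem norm_kernelVector (hL2 : IsIsometricallyInL2 H m) (hinv : IsTwistedInvariant H σ)
    (x : G) : ‖kernelVector H x‖ = ‖kernelVector H (1 : G)‖ := by
  have key : ∀ g x : G, ‖kernelVector H x‖ ≤ ‖kernelVector H (g * x)‖ := fun g x => by
    have h := congrArg norm (adjoint_twistedTranslate_kernelVector hL2 hinv g x)
    rw [norm_smul, RCLike.norm_conj, Circle.norm_coe, one_mul] at h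
    rw [← h]
    refine (ContinuousLinearMap.le_opNorm _ _).trans ?_
    rw [LinearIsometryEquiv.norm_map]
    exact mul_le_of_le_one_left (norm_nonneg _) (LinearIsometry.norm_toContinuousLinearMap_le _)
  refine le_antisymm ?_ ?_
  · simpa using key x⁻¹ x
  · simpa using key x 1

/-- Both vectors have norm `‖k_x‖` and their inner product is `‖k_x‖²`, so their difference has norm
zero. No surjectivity of the translation is needed. -/
theorem twistedTranslate_kernelVector (hL2 : IsIsometricallyInL2 H m)
    (hinv : IsTwistedInvariant H σ) (g x : G) :
    twistedTranslate hL2 hinv g (kernelVector H x) = (σ g x : ℂ) • kernelVector H (g * x) := by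
  set U := twistedTranslate hL2 hinv g
  have h1 : inner ℂ (U (kernelVector H x)) ((σ g x : ℂ) • kernelVector H (g * x)) =
      (‖kernelVector H x‖ : ℂ) ^ 2 := by
    rw [inner_smul_right, inner_kernelVector', twistedTranslate_apply_mul, map_mul,
      ← mul_assoc, Complex.mul_conj, Circle.normSq_coe, Complex.ofReal_one, one_mul,
      ← inner_kernelVector, inner_conj_symm, inner_self_eq_norm_sq_to_K]
    rfl
  rw [← sub_eq_zero, ← norm_eq_zero, ← sq_eq_zero_iff, @norm_sub_sq ℂ, h1, U.norm_map, norm_smul,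
    Circle.norm_coe, one_mul, norm_kernelVector hL2 hinv (g * x), ← norm_kernelVector hL2 hinv x]
  rw [RCLike.re_to_complex, ← Complex.ofReal_pow, Complex.ofReal_re]
  ring

include m in
theorem kernelVector_apply_mul (hL2 : IsIsometricallyInL2 H m)
    (hinv : IsTwistedInvariant H σ) (x z : G) :
    kernelVector H x (x * z) = conj (σ x 1 : ℂ) * σ x z * kernelVector H (1 : G) z := by
  have h := twistedTranslate_kernelVector hL2 hinv x 1
  rw [mul_one] at h
  have h2 := twistedTranslate_apply_mul hL2 hinv x (kernelVector H (1 : G)) z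
  rw [h, RKHS.coe_smul, Pi.smul_apply, smul_eq_mul] at h2
  rw [mul_assoc, ← h2, ← mul_assoc, mul_comm (conj _), Complex.mul_conj, Circle.normSq_coe,
    Complex.ofReal_one, one_mul]

include m σ in
theorem norm_kernelVector_apply (hL2 : IsIsometricallyInL2 H m)
    (hinv : IsTwistedInvariant H σ) (x y : G) :
    ‖kernelVector H x y‖ = ‖kernelVector H (1 : G) (x⁻¹ * y)‖ := by
  have := kernelVector_apply_mul hL2 hinv x (x⁻¹ * y)
  rw [mul_inv_cancel_left] at this
  rw [this, norm_mul, norm_mul, RCLike.norm_conj, Circle.norm_coe, Circle.norm_coe, one_mul,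
    one_mul]

end TwistedRKHS

/-! ### Projections of compactly supported functions; continuity of `H` -/

section ProjectedFunctions

open scoped ComplexConjugate

variable {G : Type*} {H : Type*} [NormedAddCommGroup H] [InnerProductSpace ℂ H] [RKHS ℂ H G ℂ]
  [CompleteSpace H]

/-- The orthogonal projection to `H` of a square-integrable function. -/
noncomputable def projL2 [MeasurableSpace G] {m : Measure G} (hL2 : IsIsometricallyInL2 H m)
    {φ : G → ℂ} (hφ : MemLp φ 2 m) : H :=
  (toL2 hL2).toContinuousLinearMap.adjoint (hφ.toLp φ)

theorem projL2_apply [MeasurableSpace G] {m : Measure G} (hL2 : IsIsometricallyInL2 H m)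
    {φ : G → ℂ} (hφ : MemLp φ 2 m) (x : G) :
    projL2 hL2 hφ x = ∫ y, conj (kernelVector H x y) * φ y ∂m := by
  rw [← inner_kernelVector, projL2, ContinuousLinearMap.adjoint_inner_right]
  change inner ℂ ((hL2 (kernelVector H x)).1.toLp _) (hφ.toLp φ) = _
  rw [L2.inner_def]
  refine integral_congr_ae ?_
  filter_upwards [(hL2 (kernelVector H x)).1.coeFn_toLp, hφ.coeFn_toLp] with y h1 h2
  rw [h1, h2, RCLike.inner_apply, mul_comm]

theorem norm_sub_projL2_le [MeasurableSpace G] {m : Measure G} (hL2 : IsIsometricallyInL2 H m)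
    {φ : G → ℂ} (hφ : MemLp φ 2 m) (f : H) :
    ‖f - projL2 hL2 hφ‖ ≤ (eLpNorm ((f : G → ℂ) - φ) 2 m).toReal := by
  have h1 : (toL2 hL2).toContinuousLinearMap.adjoint (toL2 hL2 f) = f := by
    refine ext_inner_right ℂ fun v => ?_
    rw [ContinuousLinearMap.adjoint_inner_left]
    exact (toL2 hL2).inner_map_map f v
  nth_rw 1 [← h1]
  rw [projL2, ← map_sub]
  refine (ContinuousLinearMap.le_opNorm _ _).trans ?_
  rw [LinearIsometryEquiv.norm_map, toL2_apply, ← MemLp.toLp_sub, Lp.norm_toLp]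
  exact mul_le_of_le_one_left ENNReal.toReal_nonneg (LinearIsometry.norm_toContinuousLinearMap_le _)

variable [Group G] [TopologicalSpace G] [IsTopologicalGroup G] [T2Space G] [LocallyCompactSpace G]
  [SecondCountableTopology G] [MeasurableSpace G] [BorelSpace G]
  {m : Measure G} [m.IsHaarMeasure] {σ : G → G → Circle}

theorem exists_norm_sub_projL2_lt (hL2 : IsIsometricallyInL2 H m) (f : H) {ε : ℝ} (hε : 0 < ε) :
    ∃ (φ : G → ℂ) (hφ : MemLp φ 2 m), Continuous φ ∧ HasCompactSupport φ ∧
      ‖f - projL2 hL2 hφ‖ < ε := by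
  obtain ⟨φ, hc, hle, hcont, hφ⟩ := (hL2 f).1.exists_hasCompactSupport_eLpNorm_sub_le
    (by simp) (ε := ENNReal.ofReal (ε / 2)) (by simpa using hε)
  refine ⟨φ, hφ, hcont, hc, (norm_sub_projL2_le hL2 hφ f).trans_lt ?_⟩
  calc _ ≤ (ENNReal.ofReal (ε / 2)).toReal := ENNReal.toReal_mono ENNReal.ofReal_ne_top hle
    _ < ε := by rw [ENNReal.toReal_ofReal (by positivity)]; linarith

omit [T2Space G] [SecondCountableTopology G] in
-- Substituting `y = xz` leaves the fixed factor `k_e(z)` and puts all dependence on `x` into a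
-- jointly continuous factor. For `x` in a compact set `N` that factor is supported in `N⁻¹ · supp
-- φ`.
theorem continuous_projL2 (hσ : Continuous fun p : G × G => σ p.1 p.2)
    (hL2 : IsIsometricallyInL2 H m) (hinv : IsTwistedInvariant H σ) {φ : G → ℂ} (hφ : MemLp φ 2 m)
    (hcont : Continuous φ) (hc : HasCompactSupport φ) : Continuous ⇑(projL2 hL2 hφ) := by
  let F : G → G → ℂ := fun x z => (σ x 1 : ℂ) * conj (σ x z : ℂ) * φ (x * z)
  have hF : Continuous F.uncurry := by
    have h1 : Continuous fun p : G × G => (σ p.1 1 : ℂ) :=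
      continuous_induced_dom.comp (hσ.comp (by fun_prop : Continuous fun p : G × G => (p.1, (1 : G))))
    have h2 : Continuous fun p : G × G => (σ p.1 p.2 : ℂ) := continuous_induced_dom.comp hσ
    exact (h1.mul (Complex.continuous_conj.comp h2)).mul (hcont.comp continuous_mul)
  have heq : ∀ x, projL2 hL2 hφ x =
      ∫ z, ContinuousLinearMap.mul ℂ ℂ (conj (kernelVector H (1 : G) z)) (F x z) ∂m := fun x => by
    rw [projL2_apply, ← integral_mul_left_eq_self _ x]
    refine integral_congr_ae (ae_of_all _ fun z => ?_)
    simp only [kernelVector_apply_mul hL2 hinv, map_mul, Complex.conj_conj,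
      ContinuousLinearMap.mul_apply', F]
    ring
  rw [continuous_iff_continuousAt]
  intro x₀
  obtain ⟨N, hN, hN₀⟩ := exists_compact_mem_nhds x₀
  have hint : IntegrableOn (fun z => conj (kernelVector H (1 : G) z)) (N⁻¹ * tsupport φ) m := by
    have := ((hL2 (kernelVector H (1 : G))).1.locallyIntegrable (by norm_num)).integrableOn_isCompact
      (hN.inv.mul hc.isCompact)
    exact (Complex.conjLIE.toContinuousLinearEquiv.toContinuousLinearMap :
      ℂ →L[ℝ] ℂ).integrable_comp this
  have := continuousOn_integral_bilinear_of_locally_integrable_of_compact_support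
    (ContinuousLinearMap.mul ℂ ℂ) (f := F) (s := N) (hN.inv.mul hc.isCompact) hF.continuousOn
    (fun p z hp hz => ?_) hint
  · exact ((this.congr fun x _ => heq x) x₀ (mem_of_mem_nhds hN₀)).continuousAt hN₀
  · simp only [F]
    rw [image_eq_zero_of_notMem_tsupport (f := φ) (x := p * z), mul_zero]
    intro h
    exact hz ⟨p⁻¹, Set.inv_mem_inv.2 hp, _, h, by simp⟩

include m in
-- Point evaluations all have norm `‖k_e‖`, so norm approximation by projected functions is uniform
-- approximation.
theorem continuous_coe (hσ : Continuous fun p : G × G => σ p.1 p.2)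
    (hL2 : IsIsometricallyInL2 H m) (hinv : IsTwistedInvariant H σ) (f : H) :
    Continuous (f : G → ℂ) := by
  refine continuous_of_uniform_approx_of_continuous fun u hu => ?_
  obtain ⟨ε, hε, hεu⟩ := Metric.mem_uniformity_dist.1 hu
  have hpos : 0 < ‖kernelVector H (1 : G)‖ + 1 := by positivity
  obtain ⟨φ, hφ, hcont, hc, hlt⟩ := exists_norm_sub_projL2_lt hL2 f (div_pos hε hpos)
  refine ⟨⇑(projL2 hL2 hφ), continuous_projL2 hσ hL2 hinv hφ hcont hc, fun y => hεu ?_⟩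
  rw [dist_eq_norm, ← Pi.sub_apply, ← RKHS.coe_sub]
  refine (norm_apply_le _ y).trans_lt ?_
  rw [norm_kernelVector hL2 hinv]
  rw [lt_div_iff₀ hpos] at hlt
  nlinarith [norm_nonneg (f - projL2 hL2 hφ)]

include m in
theorem continuous_kernelVector (hσ : Continuous fun p : G × G => σ p.1 p.2)
    (hL2 : IsIsometricallyInL2 H m) (hinv : IsTwistedInvariant H σ) :
    Continuous fun x : G => kernelVector H x := by
  refine continuous_iff_continuousAt.2 fun x₀ => ?_
  rw [ContinuousAt, tendsto_iff_norm_sub_tendsto_zero]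
  -- All kernel vectors have equal norm, so continuity of the single function `k_{x₀}` at `x₀`
  -- suffices.
  have h1 : ∀ x, ‖kernelVector H x - kernelVector H x₀‖ ^ 2 =
      2 * ‖kernelVector H x₀‖ ^ 2 - 2 * (kernelVector H x₀ x).re := fun x => by
    rw [@norm_sub_sq ℂ, inner_kernelVector, norm_kernelVector hL2 hinv x,
      norm_kernelVector hL2 hinv x₀, RCLike.re_to_complex]
    ring
  have h2 : (kernelVector H x₀ x₀).re = ‖kernelVector H x₀‖ ^ 2 := by
    rw [← inner_kernelVector, inner_self_eq_norm_sq_to_K]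
    norm_cast
  have h3 : Filter.Tendsto (fun x => ‖kernelVector H x - kernelVector H x₀‖ ^ 2) (𝓝 x₀) (𝓝 0) := by
    simp_rw [h1]
    have := (Complex.continuous_re.comp (continuous_coe hσ hL2 hinv (kernelVector H x₀))).tendsto x₀
    have := (this.const_mul 2).const_sub (2 * ‖kernelVector H x₀‖ ^ 2)
    rw [Function.comp_apply, h2, sub_self] at this
    exact this
  have := (Real.continuous_sqrt.tendsto 0).comp h3
  rw [Real.sqrt_zero] at this
  exact this.congr fun x => Real.sqrt_sq (norm_nonneg _)

omit [T2Space G] [LocallyCompactSpace G] [SecondCountableTopology G] in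
theorem kernelVector_one_ne_zero [Nontrivial H] (hL2 : IsIsometricallyInL2 H m)
    (hinv : IsTwistedInvariant H σ) : kernelVector H (1 : G) ≠ 0 := by
  intro h
  obtain ⟨f, hf⟩ := exists_ne (0 : H)
  refine hf (RKHS.ext fun x => ?_)
  have := norm_apply_le f x
  rw [norm_kernelVector hL2 hinv, h, norm_zero, zero_mul, norm_le_zero_iff] at this
  simpa using this

end ProjectedFunctions

/-! ### Bessel bounds, relative separation and uniform tails -/

section Sampling

variable {G : Type*} {H : Type*} [NormedAddCommGroup H] [InnerProductSpace ℂ H] [RKHS ℂ H G ℂ]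

theorem IsSetOfSampling.exists_enorm_bounds {Λ : Set G} (hΛ : IsSetOfSampling H Λ) :
    ∃ A B : ℝ≥0, 0 < A ∧ ∀ f : H, A * ‖f‖ₑ ^ 2 ≤ ∑' l : Λ, ‖f l‖ₑ ^ 2 ∧
      ∑' l : Λ, ‖f l‖ₑ ^ 2 ≤ B * ‖f‖ₑ ^ 2 := by
  obtain ⟨A, B, hA, hAB, h⟩ := hΛ
  refine ⟨A.toNNReal, B.toNNReal, by simpa using hA, fun f => ?_⟩
  obtain ⟨hs, h1, h2⟩ := h f
  have h3 : ∑' l : Λ, ‖f l‖ₑ ^ 2 = ENNReal.ofReal (∑' l : Λ, ‖f (l : G)‖ ^ 2) := by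
    rw [ENNReal.ofReal_tsum_of_nonneg (fun _ => by positivity) hs]
    exact tsum_congr fun l => by rw [ENNReal.ofReal_pow (norm_nonneg _), ofReal_norm]
  have h4 : ∀ C : ℝ, 0 ≤ C → (C.toNNReal : ℝ≥0∞) * ‖f‖ₑ ^ 2 = ENNReal.ofReal (C * ‖f‖ ^ 2) := by
    intro C hC
    rw [ENNReal.ofReal_mul hC, ENNReal.ofReal_pow (norm_nonneg _), ofReal_norm]
    rfl
  rw [h3, h4 A hA.le, h4 B (hA.le.trans hAB)]
  exact ⟨ENNReal.ofReal_le_ofReal h1, ENNReal.ofReal_le_ofReal h2⟩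

variable [CompleteSpace H] [Group G] [TopologicalSpace G] [IsTopologicalGroup G] [T2Space G]
  [LocallyCompactSpace G] [SecondCountableTopology G] [MeasurableSpace G] [BorelSpace G]
  {m : Measure G} [m.IsHaarMeasure] {σ : G → G → Circle}

/-- A set that satisfies a Bessel bound is relatively separated. -/
theorem isRelativelySeparated_of_bessel [Nontrivial H]
    (hσ : Continuous fun p : G × G => σ p.1 p.2) (hL2 : IsIsometricallyInL2 H m)
    (hinv : IsTwistedInvariant H σ) {Λ : Set G} {B : ℝ≥0}
    (hB : ∀ f : H, ∑' l : Λ, ‖f l‖ₑ ^ 2 ≤ B * ‖f‖ₑ ^ 2) : IsRelativelySeparated Λ := by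
  set k := kernelVector H (1 : G)
  have hk : 0 < ‖k‖ ^ 2 := pow_pos (norm_pos_iff.2 (kernelVector_one_ne_zero hL2 hinv)) 2
  let c : ℝ≥0 := (‖k‖ ^ 2 / 2).toNNReal
  have hc : 0 < c := by simpa [c] using hk
  -- Since `k(e) = ‖k‖²`, this is a neighborhood of `e`. Every point of `Λ` in `xU` adds at least
  -- `c²` to the sampled energy of `k_x`, which the Bessel bound controls independently of `x`.
  let U : Set G := {y | ‖k‖ ^ 2 / 2 < ‖k y‖}
  have hU : IsOpen U := isOpen_lt continuous_const (continuous_coe hσ hL2 hinv k).norm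
  have h1U : (1 : G) ∈ U := by
    change ‖k‖ ^ 2 / 2 < ‖k 1‖
    rw [← inner_kernelVector, inner_self_eq_norm_sq_to_K, norm_pow, RCLike.norm_ofReal, abs_norm]
    change ‖k‖ ^ 2 / 2 < ‖k‖ ^ 2
    linarith
  have hfin : (B * ‖k‖ₑ ^ 2 / (c : ℝ≥0∞) ^ 2 : ℝ≥0∞) ≠ ∞ :=
    ENNReal.div_ne_top (ENNReal.mul_ne_top ENNReal.coe_ne_top (by simp)) (by simpa using hc.ne')
  obtain ⟨l, hl⟩ := ENNReal.exists_nat_gt hfin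
  refine ⟨l, U, hU, ⟨1, h1U⟩, fun x => ?_⟩
  have h2 : (c : ℝ≥0∞) ^ 2 * (Λ ∩ x • U).encard ≤ B * ‖k‖ₑ ^ 2 := by
    calc (c : ℝ≥0∞) ^ 2 * (Λ ∩ x • U).encard
        = ∑' l : Λ, (x • U).indicator (fun _ => (c : ℝ≥0∞) ^ 2) (l : G) := by
          rw [tsum_subtype Λ ((x • U).indicator fun _ => (c : ℝ≥0∞) ^ 2), Set.indicator_indicator,
            ← tsum_subtype, ENNReal.tsum_set_const, mul_comm]
      _ ≤ ∑' l : Λ, ‖kernelVector H x l‖ₑ ^ 2 := by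
          refine ENNReal.tsum_le_tsum fun l => ?_
          by_cases hl : (l : G) ∈ x • U
          swap
          · rw [Set.indicator_of_notMem hl]
            exact zero_le
          rw [Set.indicator_of_mem hl]
          obtain ⟨u, hu, hul⟩ := hl
          rw [← hul]
          gcongr
          rw [← ofReal_norm, norm_kernelVector_apply hL2 hinv]
          dsimp only
          rw [smul_eq_mul, inv_mul_cancel_left]
          exact ENNReal.ofReal_le_ofReal (le_of_lt hu)
      _ ≤ B * ‖kernelVector H x‖ₑ ^ 2 := hB _
      _ = B * ‖k‖ₑ ^ 2 := by rw [← ofReal_norm, norm_kernelVector hL2 hinv, ofReal_norm]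
  have h3 : ((Λ ∩ x • U).encard : ℝ≥0∞) ≤ l := by
    refine le_trans ?_ hl.le
    rw [ENNReal.le_div_iff_mul_le (by simp [hc.ne']) (by simp), mul_comm]
    exact h2
  exact_mod_cast h3

omit [CompleteSpace H] [LocallyCompactSpace G] [SecondCountableTopology G] in
theorem lintegral_enorm_sq_translate (hL2 : IsIsometricallyInL2 H m)
    (hinv : IsTwistedInvariant H σ) (x : G) (P : ClosedSubsets G) (f : H) :
    ∫⁻ y, ‖f y‖ₑ ^ 2 ∂pointMeasure (translate x P) =
      ∫⁻ y, ‖twistedTranslate hL2 hinv x⁻¹ f y‖ₑ ^ 2 ∂pointMeasure P := by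
  rw [lintegral_pointMeasure_translate]
  refine lintegral_congr fun y => ?_
  rw [twistedTranslate_apply, enorm_mul, inv_inv, ← ofReal_norm (σ _ _ : ℂ), Circle.norm_coe,
    ENNReal.ofReal_one, one_mul]

omit [CompleteSpace H] [LocallyCompactSpace G] in
include m σ in
theorem bessel_translate (hL2 : IsIsometricallyInL2 H m) (hinv : IsTwistedInvariant H σ)
    {Λ : Set G} (hΛ : IsClosed Λ) {B : ℝ≥0}
    (hB : ∀ f : H, ∑' l : Λ, ‖f l‖ₑ ^ 2 ≤ B * ‖f‖ₑ ^ 2) (x : G) (f : H) :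
    ∫⁻ y, ‖f y‖ₑ ^ 2 ∂pointMeasure (translate x (.mk Λ hΛ)) ≤ B * ‖f‖ₑ ^ 2 := by
  rw [lintegral_enorm_sq_translate hL2 hinv, lintegral_pointMeasure]
  refine (hB _).trans_eq ?_
  rw [(twistedTranslate hL2 hinv x⁻¹).enorm_map]

omit [CompleteSpace H] [LocallyCompactSpace G] in
include m σ in
theorem lower_bound_translate (hL2 : IsIsometricallyInL2 H m) (hinv : IsTwistedInvariant H σ)
    {Λ : Set G} (hΛ : IsClosed Λ) {A : ℝ≥0}
    (hA : ∀ f : H, A * ‖f‖ₑ ^ 2 ≤ ∑' l : Λ, ‖f l‖ₑ ^ 2) (x : G) (f : H) :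
    A * ‖f‖ₑ ^ 2 ≤ ∫⁻ y, ‖f y‖ₑ ^ 2 ∂pointMeasure (translate x (.mk Λ hΛ)) := by
  rw [lintegral_enorm_sq_translate hL2 hinv, lintegral_pointMeasure]
  refine le_trans (le_of_eq ?_) (hA _)
  rw [(twistedTranslate hL2 hinv x⁻¹).enorm_map]

include m in
/-- Every element of the hull satisfies the Bessel bound of `Λ`. -/
theorem bessel_hull (hσ : Continuous fun p : G × G => σ p.1 p.2) (hL2 : IsIsometricallyInL2 H m)
    (hinv : IsTwistedInvariant H σ) {Λ : Set G} (hΛ : IsClosed Λ) {B : ℝ≥0}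
    (hB : ∀ f : H, ∑' l : Λ, ‖f l‖ₑ ^ 2 ≤ B * ‖f‖ₑ ^ 2) {P : ClosedSubsets G} (hP : P ∈ hull Λ)
    (f : H) : ∫⁻ y, ‖f y‖ₑ ^ 2 ∂pointMeasure P ≤ B * ‖f‖ₑ ^ 2 := by
  refine hull_induction hΛ (p := fun P => ∫⁻ y, ‖f y‖ₑ ^ 2 ∂pointMeasure P ≤ B * ‖f‖ₑ ^ 2) ?_
    (fun x => bessel_translate hL2 hinv hΛ hB x f) hP
  refine (lowerSemicontinuous_lintegral_pointMeasure ?_).isClosed_preimage _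
  exact ((ENNReal.continuous_pow 2).comp (continuous_coe hσ hL2 hinv f).enorm).lowerSemicontinuous

omit [CompleteSpace H] [m.IsHaarMeasure] in
/-- The function `|f|²` has small integral off some compact set. -/
theorem exists_isCompact_lintegral_compl_le (hL2 : IsIsometricallyInL2 H m) (f : H) {δ : ℝ≥0∞}
    (hδ : δ ≠ 0) : ∃ L : Set G, IsCompact L ∧ ∫⁻ x in Lᶜ, ‖f x‖ₑ ^ 2 ∂m ≤ δ := by
  let ρ := m.withDensity fun x => ‖f x‖ₑ ^ 2
  have hρ : IsFiniteMeasure ρ := isFiniteMeasure_withDensity (by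
    rw [lintegral_enorm_sq_eq hL2]; simp)
  obtain ⟨L, -, hL, hlt⟩ := MeasurableSet.univ.exists_isCompact_sdiff_lt (μ := ρ) (measure_ne_top _ _) hδ
  refine ⟨L, hL, ?_⟩
  rw [← withDensity_apply _ hL.measurableSet.compl, Set.compl_eq_univ_sdiff]
  exact hlt.le

omit [T2Space G] [LocallyCompactSpace G] [SecondCountableTopology G] in
/-- The Cauchy--Schwarz bound for the values of a projected function. -/
theorem enorm_projL2_sq_le (hL2 : IsIsometricallyInL2 H m) (hinv : IsTwistedInvariant H σ)
    {φ : G → ℂ} (hφ : MemLp φ 2 m) (x : G) :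
    ‖projL2 hL2 hφ x‖ₑ ^ 2 ≤
      (∫⁻ z in (fun z => x * z) ⁻¹' tsupport φ, ‖kernelVector H (1 : G) z‖ₑ ^ 2 ∂m) *
        ∫⁻ y, ‖φ y‖ₑ ^ 2 ∂m := by
  let S := tsupport φ
  have hS : MeasurableSet S := (isClosed_tsupport φ).measurableSet
  have h1 : ‖projL2 hL2 hφ x‖ₑ ≤ ∫⁻ y, (S.indicator (fun y => ‖kernelVector H x y‖ₑ) * fun y =>
      ‖φ y‖ₑ) y ∂m := by
    rw [projL2_apply]
    refine (enorm_integral_le_lintegral_enorm _).trans_eq (lintegral_congr fun y => ?_)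
    by_cases hy : y ∈ S
    · simp [Set.indicator_of_mem hy]
    · simp [image_eq_zero_of_notMem_tsupport hy]
  have h2 := h1.trans (ENNReal.lintegral_mul_le_Lp_mul_Lq m Real.HolderConjugate.two_two
    ((hL2 (kernelVector H x)).1.1.enorm.indicator hS) hφ.1.enorm)
  have h3 : ∀ a b : ℝ≥0∞, (a ^ (1 / 2 : ℝ) * b ^ (1 / 2 : ℝ)) ^ 2 = a * b := fun a b => by
    rw [← ENNReal.mul_rpow_of_nonneg _ _ (by norm_num), ← ENNReal.rpow_natCast, ← ENNReal.rpow_mul]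
    norm_num
  refine (pow_le_pow_left' h2 2).trans_eq ?_
  rw [h3]
  simp only [ENNReal.rpow_ofNat]
  congr 1
  rw [← lintegral_mul_left_eq_self _ x, ← lintegral_indicator (measurable_const_mul x hS)]
  refine lintegral_congr fun z => ?_
  by_cases hz : x * z ∈ S
  · rw [Set.indicator_of_mem hz, Set.indicator_of_mem (by exact hz), ← ofReal_norm,
      norm_kernelVector_apply hL2 hinv, inv_mul_cancel_left, ofReal_norm]
  · rw [Set.indicator_of_notMem hz, Set.indicator_of_notMem (by exact hz)]
    simp

/-- The tails of the sampled energy of a projected function are small, uniformly over the hull. -/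
theorem exists_isCompact_tail_le (hIN : IsINGroup G) (hσ : Continuous fun p : G × G => σ p.1 p.2)
    (hL2 : IsIsometricallyInL2 H m)
    (hinv : IsTwistedInvariant H σ) {Λ : Set G} (hΛ : IsRelativelySeparated Λ) {φ : G → ℂ}
    (hφ : MemLp φ 2 m) (hc : HasCompactSupport φ) {ε : ℝ≥0} (hε : 0 < ε) :
    ∃ K : Set G, IsCompact K ∧ ∀ P ∈ hull Λ,
      ∫⁻ y in Kᶜ, ‖projL2 hL2 hφ y‖ₑ ^ 2 ∂pointMeasure P ≤ ε := by
  set k := kernelVector H (1 : G)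
  set S := tsupport φ
  have hS : MeasurableSet S := (isClosed_tsupport φ).measurableSet
  obtain ⟨N, hN⟩ := exists_pointMeasure_preimage_mul_right_le hIN hΛ hc.isCompact
  set M : ℝ≥0∞ := ∫⁻ y, ‖φ y‖ₑ ^ 2 ∂m
  have hM : M ≠ ∞ := by
    have h2 := lintegral_rpow_enorm_lt_top_of_eLpNorm_lt_top (by simp) (by simp) hφ.2
    simpa using h2.ne
  obtain ⟨L, hL, hLδ⟩ := exists_isCompact_lintegral_compl_le hL2 k
    -- The final tail bound is `N · δ · M`; the `+ 1` keeps the denominator nonzero.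
    (δ := ε / (N * M + 1)) (by
      rw [ne_eq, ENNReal.div_eq_zero_iff, not_or]
      exact ⟨by simpa using hε.ne',
        ENNReal.add_ne_top.2 ⟨ENNReal.mul_ne_top (ENNReal.natCast_ne_top N) hM, by simp⟩⟩)
  -- If `y ∉ S L⁻¹` and `yz ∈ S`, then `z ∉ L`. After Tonelli only the tail of `k_e` off `L`
  -- remains, with each `z` counted at most `N` times.
  have hK : IsCompact (S * L⁻¹) := hc.isCompact.mul hL.inv
  refine ⟨S * L⁻¹, hK, fun P hP => ?_⟩
  have := isFiniteMeasureOnCompacts_pointMeasure hΛ hP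
  have hk : Measurable fun z => ‖k z‖ₑ ^ 2 :=
    ((ENNReal.continuous_pow 2).comp (continuous_coe hσ hL2 hinv k).enorm).measurable
  have hmeas : Measurable fun p : G × G =>
      ((fun q : G × G => q.1 * q.2) ⁻¹' S).indicator (fun q => ‖k q.2‖ₑ ^ 2) p :=
    (hk.comp measurable_snd).indicator (measurable_mul hS)
  calc ∫⁻ y in (S * L⁻¹)ᶜ, ‖projL2 hL2 hφ y‖ₑ ^ 2 ∂pointMeasure P
      ≤ ∫⁻ y in (S * L⁻¹)ᶜ, (∫⁻ z, ((fun q : G × G => q.1 * q.2) ⁻¹' S).indicator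
          (fun q => ‖k q.2‖ₑ ^ 2) (y, z) ∂m) * M ∂pointMeasure P := by
        refine lintegral_mono fun y => (enorm_projL2_sq_le hL2 hinv hφ y).trans_eq ?_
        rw [← lintegral_indicator (measurable_const_mul y hS)]
        rfl
    _ = (∫⁻ z, ∫⁻ y in (S * L⁻¹)ᶜ, ((fun q : G × G => q.1 * q.2) ⁻¹' S).indicator
          (fun q => ‖k q.2‖ₑ ^ 2) (y, z) ∂pointMeasure P ∂m) * M := by
        rw [lintegral_mul_const _ hmeas.lintegral_prod_right',
          lintegral_lintegral_swap hmeas.aemeasurable]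
    _ ≤ (∫⁻ z in Lᶜ, N * ‖k z‖ₑ ^ 2 ∂m) * M := by
        refine mul_le_mul_left ?_ M
        rw [← lintegral_indicator hL.measurableSet.compl]
        refine lintegral_mono fun z => ?_
        by_cases hz : z ∈ L
        · rw [Set.indicator_of_notMem (by simpa using hz), nonpos_iff_eq_zero]
          refine (setLIntegral_congr_fun hK.measurableSet.compl fun y hy => ?_).trans
            lintegral_zero
          refine Set.indicator_of_notMem (fun hyz => hy ?_) _
          exact ⟨y * z, hyz, z⁻¹, Set.inv_mem_inv.2 hz, by simp⟩
        · rw [Set.indicator_of_mem (by simpa using hz)]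
          calc _ ≤ ∫⁻ y, ((fun x => x * z) ⁻¹' S).indicator (fun _ => ‖k z‖ₑ ^ 2) y
                ∂pointMeasure P := setLIntegral_le_lintegral _ _
            _ = ‖k z‖ₑ ^ 2 * pointMeasure P ((fun x => x * z) ⁻¹' S) :=
                lintegral_indicator_const (measurable_mul_const z hS) _
            _ ≤ N * ‖k z‖ₑ ^ 2 := by
                rw [mul_comm]
                gcongr
                exact hN P hP z
    _ ≤ (N * (ε / (N * M + 1))) * M := by
        rw [lintegral_const_mul _ hk]
        gcongr
    _ = ε * (N * M / (N * M + 1)) := by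
        rw [div_eq_mul_inv, div_eq_mul_inv]
        ring
    _ ≤ ε := mul_le_of_le_one_right' (ENNReal.div_le_of_le_mul (by simp))

end Sampling

/-! ### Passing lower bounds to limits in the hull -/

section LowerBound

variable {G : Type*} [Group G] [TopologicalSpace G] [IsTopologicalGroup G] [T2Space G]
  [MeasurableSpace G] [BorelSpace G]

/-- A lower bound for the sums of `g` over the translates of `Λ` passes to the hull, with a loss
that accounts for the multiplicity of limit points, if the tails of the sums are uniformly small. -/
theorem le_lintegral_pointMeasure_of_tail {Λ : Set G} (hΛ : IsRelativelySeparated Λ) {l : ℕ}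
    {U : Set G} (hU : IsOpen U) (h1 : (1 : G) ∈ U) (hl : ∀ x : G, (Λ ∩ x • U).encard ≤ l)
    {g : G → ℝ≥0∞} (hg : Continuous g) (hg' : ∀ x, g x ≠ ∞) {a : ℝ≥0∞}
    (ha : ∀ x : G, a ≤ ∫⁻ y, g y ∂pointMeasure (translate x (.mk Λ hΛ.isClosed)))
    (htail : ∀ ε : ℝ≥0, 0 < ε → ∃ K : Set G, IsCompact K ∧ ∀ P ∈ hull Λ,
      ∫⁻ y in Kᶜ, g y ∂pointMeasure P ≤ ε) {P : ClosedSubsets G} (hP : P ∈ hull Λ) :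
    a ≤ l * ∫⁻ y, g y ∂pointMeasure P := by
  refine ENNReal.le_of_forall_pos_le_add fun ε hε _ => ?_
  obtain ⟨K, hK, hKε⟩ := htail (ε / 2) (half_pos hε)
  obtain ⟨N, hN⟩ := exists_pointMeasure_le hΛ hK
  have hfin : ((P : Set G) ∩ K).Finite := by
    have := hN P hP
    rw [pointMeasure_apply P hK.measurableSet] at this
    exact Set.finite_of_encard_le_coe (k := N) (by exact_mod_cast this)
  let s := hfin.toFinset
  -- Each point of `P ∩ K` may attract up to `l` points of a nearby translate, each with error `δ`;
  -- the total error is at most `ε / 2`.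
  let δ : ℝ≥0 := ε / 2 / (l * s.card + 1)
  have hδ : 0 < δ := by positivity
  let W : G → Set G := fun p => p • U ∩ {x | g x < g p + δ}
  have hW : ∀ p, IsOpen (W p) := fun p => (hU.smul p).inter (isOpen_lt hg continuous_const)
  have hpW : ∀ p, p ∈ W p := fun p => ⟨by simpa [Set.mem_smul_set_iff_inv_smul_mem] using h1,
    ENNReal.lt_add_right (hg' p) (by simpa using hδ.ne')⟩
  let V : Set G := ⋃ p : s, W p
  have hV : IsOpen V := isOpen_iUnion fun p => hW p
  have hPV : (P : Set G) ∩ (K \ V) = ∅ := by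
    refine Set.eq_empty_iff_forall_notMem.2 fun p ⟨hp, hpK, hpV⟩ => hpV ?_
    exact Set.mem_iUnion.2 ⟨⟨p, hfin.mem_toFinset.2 ⟨hp, hpK⟩⟩, hpW p⟩
  -- A translate of `Λ` close to `P` has all its points in `K` inside `V`, hence near points of `P`.
  obtain ⟨x, hx⟩ := exists_translate_mem_of_mem_hull hΛ.isClosed hP
    (isOpen_setOf_inter_eq_empty (hK.diff hV)) hPV
  have hC := translate_mk_mem_hull hΛ.isClosed x
  set C := translate x (.mk Λ hΛ.isClosed)
  have hzero : pointMeasure C (K \ V) = 0 := by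
    rw [pointMeasure_apply C (hK.measurableSet.diff hV.measurableSet), show (C : Set G) ∩ _ = ∅ from hx]
    simp
  have hWl : ∀ p, ∫⁻ y in W p, g y ∂pointMeasure C ≤ (g p + δ) * l := fun p => by
    calc ∫⁻ y in W p, g y ∂pointMeasure C ≤ ∫⁻ y in W p, (g p + δ) ∂pointMeasure C :=
          setLIntegral_mono' (hW p).measurableSet fun y hy => le_of_lt hy.2
      _ = (g p + δ) * pointMeasure C (W p) := setLIntegral_const _ _
      _ ≤ (g p + δ) * l := by
          gcongr
          exact (measure_mono Set.inter_subset_left).trans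
            (pointMeasure_smul_le hΛ.isClosed hU hl hC p)
  have hsum : ∑ p ∈ s, g p ≤ ∫⁻ y, g y ∂pointMeasure P := by
    rw [lintegral_pointMeasure]
    change ∑ p ∈ s, g p ≤ ∑' x : (P : Set G), g x
    rw [tsum_subtype (P : Set G) g]
    refine le_trans (Finset.sum_le_sum fun p hp => ?_) (ENNReal.sum_le_tsum s)
    rw [Set.indicator_of_mem (hfin.mem_toFinset.1 hp).1]
  have hδε : (l * (s.card * δ) : ℝ≥0∞) ≤ (ε / 2 : ℝ≥0) := by
    have : (l * (s.card * δ) : ℝ≥0) ≤ ε / 2 := by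
      have h3 : (l * s.card + 1 : ℝ≥0) * δ = ε / 2 := by
        simp only [δ]
        field_simp
      rw [← h3, ← mul_assoc]
      gcongr
      exact le_self_add
    exact_mod_cast this
  calc a ≤ ∫⁻ y, g y ∂pointMeasure C := ha x
    _ ≤ ∫⁻ y in Kᶜ ∪ (K \ V ∪ V), g y ∂pointMeasure C := by
        rw [Set.sdiff_union_self, ← Set.union_assoc, Set.compl_union_self, Set.univ_union,
          Measure.restrict_univ]
    _ ≤ ∫⁻ y in Kᶜ, g y ∂pointMeasure C + (∫⁻ y in K \ V, g y ∂pointMeasure C +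
          ∫⁻ y in V, g y ∂pointMeasure C) :=
        (lintegral_union_le _ _ _).trans (add_le_add_right (lintegral_union_le _ _ _) _)
    _ ≤ (ε / 2 : ℝ≥0) + (0 + ∑ p ∈ s, (g p + δ) * l) := by
        refine add_le_add (hKε C hC) (add_le_add (setLIntegral_measure_zero _ _ hzero).le ?_)
        refine (lintegral_iUnion_le _ _).trans ?_
        rw [tsum_fintype, Finset.sum_coe_sort s fun p => ∫⁻ y in W p, g y ∂pointMeasure C]
        exact Finset.sum_le_sum fun p _ => hWl p
    _ = (ε / 2 : ℝ≥0) + (l * ∑ p ∈ s, g p + l * (s.card * δ)) := by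
        rw [← Finset.sum_mul, Finset.sum_add_distrib, Finset.sum_const, nsmul_eq_mul, zero_add]
        ring
    _ ≤ (ε / 2 : ℝ≥0) + (l * ∫⁻ y, g y ∂pointMeasure P + (ε / 2 : ℝ≥0)) := by gcongr
    _ = l * ∫⁻ y, g y ∂pointMeasure P + ε := by
        rw [add_left_comm, ← ENNReal.coe_add, add_halves]

end LowerBound

/-! ### Analysis operators and the lower frame bound on the hull -/

section AnalysisOperator

variable {G : Type*} {H : Type*} [NormedAddCommGroup H] [InnerProductSpace ℂ H] [RKHS ℂ H G ℂ]

theorem summable_norm_sq_of_tsum_enorm_le {P : Set G} {B : ℝ≥0}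
    (hB : ∀ f : H, ∑' p : P, ‖f p‖ₑ ^ 2 ≤ B * ‖f‖ₑ ^ 2) (f : H) :
    Summable fun p : P => ‖f (p : G)‖ ^ 2 := by
  have h : ∑' p : P, ‖f p‖ₑ ^ 2 ≠ ∞ :=
    ne_top_of_le_ne_top (ENNReal.mul_ne_top ENNReal.coe_ne_top (by simp)) (hB f)
  simpa using ENNReal.summable_toReal h

theorem enorm_lp_two_sq {ι : Type*} (v : lp (fun _ : ι => ℂ) 2) :
    ‖v‖ₑ ^ 2 = ∑' i, ‖v i‖ₑ ^ 2 := by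
  have h1 := lp.norm_rpow_eq_tsum (p := 2) (by norm_num) v
  have h2 := (lp.memℓp v).summable (by norm_num)
  simp only [ENNReal.toReal_ofNat, Real.rpow_ofNat] at h1 h2
  rw [← ofReal_norm, ← ENNReal.ofReal_pow (norm_nonneg _), h1,
    ENNReal.ofReal_tsum_of_nonneg (fun _ => by positivity) h2]
  exact tsum_congr fun i => by rw [ENNReal.ofReal_pow (norm_nonneg _), ofReal_norm]

/-- The analysis operator `f ↦ (f(p))_{p ∈ P}` of a set that satisfies a Bessel bound. -/
noncomputable def analysisOperator {P : Set G} {B : ℝ≥0}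
    (hB : ∀ f : H, ∑' p : P, ‖f p‖ₑ ^ 2 ≤ B * ‖f‖ₑ ^ 2) :
    H →L[ℂ] lp (fun _ : P => ℂ) 2 :=
  LinearMap.mkContinuous
    { toFun := fun f => ⟨fun p => f p, memℓp_gen (by
        simpa using summable_norm_sq_of_tsum_enorm_le hB f)⟩
      map_add' := fun f g => by
        ext p
        simp only [RKHS.coe_add, Pi.add_apply]
        rfl
      map_smul' := fun c f => by
        ext p
        simp } (NNReal.sqrt B) fun f => by
      set v : lp (fun _ : P => ℂ) 2 := _
      change ‖v‖ ≤ _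
      have h : ‖v‖ₑ ^ 2 ≤ B * ‖f‖ₑ ^ 2 := (enorm_lp_two_sq v).trans_le (hB f)
      have h' : ‖v‖₊ ^ 2 ≤ B * ‖f‖₊ ^ 2 := by
        simpa only [enorm_eq_nnnorm, ← ENNReal.coe_pow, ← ENNReal.coe_mul, ENNReal.coe_le_coe] using h
      have h'' : ‖v‖₊ ≤ NNReal.sqrt B * ‖f‖₊ := by
        rw [← NNReal.sqrt_sq ‖f‖₊, ← NNReal.sqrt_mul, ← NNReal.sqrt_sq ‖v‖₊]
        exact NNReal.sqrt_le_sqrt.2 h'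
      exact (NNReal.coe_le_coe.2 h'').trans_eq (by simp)

theorem analysisOperator_apply {P : Set G} {B : ℝ≥0}
    (hB : ∀ f : H, ∑' p : P, ‖f p‖ₑ ^ 2 ≤ B * ‖f‖ₑ ^ 2) (f : H) (p : P) :
    analysisOperator hB f p = f p := rfl

theorem enorm_analysisOperator_sq {P : Set G} {B : ℝ≥0}
    (hB : ∀ f : H, ∑' p : P, ‖f p‖ₑ ^ 2 ≤ B * ‖f‖ₑ ^ 2) (f : H) :
    ‖analysisOperator hB f‖ₑ ^ 2 = ∑' p : P, ‖f p‖ₑ ^ 2 :=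
  enorm_lp_two_sq _

theorem adjoint_analysisOperator_single [CompleteSpace H] [DecidableEq G] {P : Set G} {B : ℝ≥0}
    (hB : ∀ f : H, ∑' p : P, ‖f p‖ₑ ^ 2 ≤ B * ‖f‖ₑ ^ 2) (p : P) :
    (analysisOperator hB).adjoint (lp.single 2 p (1 : ℂ)) = kernelVector H (p : G) := by
  refine ext_inner_right ℂ fun f => ?_
  rw [ContinuousLinearMap.adjoint_inner_left, lp.inner_single_left, inner_kernelVector,
    analysisOperator_apply]
  simp

variable [CompleteSpace H] [Group G] [TopologicalSpace G] [IsTopologicalGroup G] [T2Space G]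
  [LocallyCompactSpace G] [SecondCountableTopology G] [MeasurableSpace G] [BorelSpace G]
  {m : Measure G} [m.IsHaarMeasure] {σ : G → G → Circle}

include m in
/-- The elements of the hull of a set of sampling are sets of sampling, with uniform bounds. -/
theorem exists_lower_bound_hull (hIN : IsINGroup G) (hσ : Continuous fun p : G × G => σ p.1 p.2)
    (hL2 : IsIsometricallyInL2 H m) (hinv : IsTwistedInvariant H σ) {Λ : Set G}
    (hΛ : IsRelativelySeparated Λ) {A B : ℝ≥0} (hA0 : 0 < A)
    (hA : ∀ f : H, A * ‖f‖ₑ ^ 2 ≤ ∑' l : Λ, ‖f l‖ₑ ^ 2)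
    (hB : ∀ f : H, ∑' l : Λ, ‖f l‖ₑ ^ 2 ≤ B * ‖f‖ₑ ^ 2) :
    ∃ A' : ℝ≥0, 0 < A' ∧ ∀ P ∈ hull Λ, ∀ f : H, A' * ‖f‖ₑ ^ 2 ≤ ∑' p : P, ‖f p‖ₑ ^ 2 := by
  obtain ⟨l, U, hU, h1, hl⟩ := hΛ.exists_nhds_one
  -- The multiplicity loss is `l`; using `l + 1` avoids division by zero.
  refine ⟨A / (l + 1), by positivity, fun P hP f => ?_⟩
  have hBP : ∀ f : H, ∑' p : (P : Set G), ‖f p‖ₑ ^ 2 ≤ B * ‖f‖ₑ ^ 2 := fun f => by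
    have := bessel_hull hσ hL2 hinv hΛ.isClosed hB hP f
    rwa [lintegral_pointMeasure] at this
  -- Tails are controlled only for projected functions. These are dense, and the Bessel bound makes
  -- the inequality a closed condition on `f`.
  have hclosed : IsClosed {f : H | A * ‖f‖ₑ ^ 2 ≤ ((l : ℝ≥0∞) + 1) * ‖analysisOperator hBP f‖ₑ ^ 2} := by
    refine isClosed_le ?_ ?_
    · exact (ENNReal.continuous_const_mul ENNReal.coe_ne_top).comp
        ((ENNReal.continuous_pow 2).comp continuous_enorm)
    · exact (ENNReal.continuous_const_mul (by simp)).comp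
        ((ENNReal.continuous_pow 2).comp (analysisOperator hBP).continuous.enorm)
  have hf : A * ‖f‖ₑ ^ 2 ≤ ((l : ℝ≥0∞) + 1) * ‖analysisOperator hBP f‖ₑ ^ 2 := by
    refine hclosed.closure_subset (Metric.mem_closure_iff.2 fun ε hε => ?_)
    obtain ⟨φ, hφ, hcont, hc, hlt⟩ := exists_norm_sub_projL2_lt hL2 f hε
    refine ⟨projL2 hL2 hφ, ?_, by rwa [dist_eq_norm]⟩
    rw [Set.mem_ofPred_eq, enorm_analysisOperator_sq]
    have := le_lintegral_pointMeasure_of_tail hΛ hU h1 hl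
      ((ENNReal.continuous_pow 2).comp (continuous_coe hσ hL2 hinv (projL2 hL2 hφ)).enorm)
      (by simp) (fun x => lower_bound_translate hL2 hinv hΛ.isClosed hA x (projL2 hL2 hφ))
      (fun ε hε => exists_isCompact_tail_le hIN hσ hL2 hinv hΛ hφ hc hε) hP
    rw [lintegral_pointMeasure] at this
    refine this.trans ?_
    gcongr
    · exact le_self_add
    · rfl
  rw [enorm_analysisOperator_sq] at hf
  rw [ENNReal.coe_div (by positivity), div_eq_mul_inv, mul_right_comm, ← div_eq_mul_inv]
  refine ENNReal.div_le_of_le_mul ?_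
  rw [mul_comm (tsum _)]
  push_cast
  exact hf

end AnalysisOperator

/-! ### Approximate inverse square roots of frame operators -/

section Spectral

open Polynomial

/-- Polynomial approximation of `t ↦ 1 / √t` on `[A, B]`. -/
theorem exists_polynomial_abs_mul_sq_sub_one_le {A B ε : ℝ} (hA : 0 < A) (hε : 0 < ε) :
    ∃ h : ℝ[X], ∀ t ∈ Set.Icc A B, |t * h.eval t ^ 2 - 1| ≤ ε := by
  -- With `u = √t · h(t) - 1` one has `t h(t)² - 1 = u(u + 2)`, and `η(η + 2) ≤ (ε / 3) · 3`.
  set η := min 1 (ε / 3)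
  have hη : 0 < η := by positivity
  obtain ⟨h, hh⟩ := exists_polynomial_near_of_continuousOn A B (fun t => (√t)⁻¹)
    (Real.continuous_sqrt.continuousOn.inv₀ fun t ht => (Real.sqrt_pos.2 (hA.trans_le ht.1)).ne')
    (η / (√B + 1)) (by positivity)
  refine ⟨h, fun t ht => ?_⟩
  have ht0 : 0 < √t := Real.sqrt_pos.2 (hA.trans_le ht.1)
  have h1 : |√t * h.eval t - 1| ≤ η := by
    have : √t * h.eval t - 1 = √t * (h.eval t - (√t)⁻¹) := by field_simp
    rw [this, abs_mul, abs_of_pos ht0]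
    calc √t * |h.eval t - (√t)⁻¹| ≤ √B * (η / (√B + 1)) := by
          gcongr
          · exact ht.2
          · exact (hh t ht).le
      _ ≤ (√B + 1) * (η / (√B + 1)) := by gcongr; linarith
      _ = η := by field_simp
  have h2 : t * h.eval t ^ 2 - 1 = (√t * h.eval t - 1) * (√t * h.eval t - 1 + 2) := by
    nth_rw 1 [← Real.sq_sqrt (hA.trans_le ht.1).le]
    ring
  rw [h2, abs_mul]
  calc _ ≤ η * (η + 2) := by
        gcongr
        exact (abs_add_le _ _).trans (by rw [abs_two]; gcongr)
    _ ≤ ε / 3 * (1 + 2) := by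
        gcongr
        · exact min_le_right _ _
        · exact min_le_left _ _
    _ = ε := by ring

variable {E F : Type*} [NormedAddCommGroup E] [InnerProductSpace ℂ E] [CompleteSpace E]
  [NormedAddCommGroup F] [InnerProductSpace ℂ F] [CompleteSpace F]

/-- The two hypotheses are the operator inequalities `A ≤ C†C ≤ B` read on quadratic forms. -/
theorem spectrum_adjoint_comp_self_subset (C : E →L[ℂ] F) {A B : ℝ}
    (hA : ∀ f, A * ‖f‖ ^ 2 ≤ ‖C f‖ ^ 2) (hB : ∀ f, ‖C f‖ ^ 2 ≤ B * ‖f‖ ^ 2) :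
    spectrum ℝ (C.adjoint ∘L C) ⊆ Set.Icc A B := by
  have hS : IsSelfAdjoint (C.adjoint ∘L C) := C.isPositive_adjoint_comp_self.isSelfAdjoint
  have hc : ∀ (r : ℝ) (f : E), (algebraMap ℝ (E →L[ℂ] E) r) f = (r : ℂ) • f := fun r f => by
    rw [Algebra.algebraMap_eq_smul_one]
    simp
  have hsa : ∀ r : ℝ, IsSelfAdjoint (algebraMap ℝ (E →L[ℂ] E) r) := fun r =>
    IsSelfAdjoint.algebraMap _ (IsSelfAdjoint.all r)
  have hin : ∀ f, (C.adjoint ∘L C).reApplyInnerSelf f = ‖C f‖ ^ 2 := fun f => by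
    rw [ContinuousLinearMap.reApplyInnerSelf_apply, ContinuousLinearMap.comp_apply,
      ContinuousLinearMap.adjoint_inner_left, inner_self_eq_norm_sq]
  have hin' : ∀ (r : ℝ) f, (algebraMap ℝ (E →L[ℂ] E) r).reApplyInnerSelf f = r * ‖f‖ ^ 2 := by
    intro r f
    rw [ContinuousLinearMap.reApplyInnerSelf_apply, hc, inner_smul_left, inner_self_eq_norm_sq_to_K]
    simp [← Complex.ofReal_pow]
  intro t ht
  constructor
  · refine (algebraMap_le_iff_le_spectrum hS).1 ?_ t ht
    refine (ContinuousLinearMap.le_def _ _).2 (ContinuousLinearMap.isPositive_def'.2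
      ⟨hS.sub (hsa A), fun f => ?_⟩)
    have := hA f
    have h2 := hin f
    have h3 := hin' A f
    simp only [ContinuousLinearMap.reApplyInnerSelf_apply, sub_apply,
      inner_sub_left, map_sub] at h2 h3 ⊢
    linarith
  · refine (le_algebraMap_iff_spectrum_le hS).1 ?_ t ht
    refine (ContinuousLinearMap.le_def _ _).2 (ContinuousLinearMap.isPositive_def'.2
      ⟨(hsa B).sub hS, fun f => ?_⟩)
    have := hB f
    have h2 := hin f
    have h3 := hin' B f
    simp only [ContinuousLinearMap.reApplyInnerSelf_apply, sub_apply,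
      inner_sub_left, map_sub] at h2 h3 ⊢
    linarith

theorem isSelfAdjoint_aeval (C : E →L[ℂ] F) (h : ℝ[X]) :
    IsSelfAdjoint (aeval (C.adjoint ∘L C) h) := by
  have hS : IsSelfAdjoint (C.adjoint ∘L C) := C.isPositive_adjoint_comp_self.isSelfAdjoint
  rw [← cfc_polynomial h _ hS]
  exact IsSelfAdjoint.cfc

/-- For `S = C†C` and a polynomial `h` with `h(t) ≈ 1 / √t` on the spectrum of `S`, the operator
`C h(S)` is almost isometric. -/
theorem abs_norm_sq_aeval_sub_le (C : E →L[ℂ] F) {A B ε : ℝ}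
    (hA : ∀ f, A * ‖f‖ ^ 2 ≤ ‖C f‖ ^ 2) (hB : ∀ f, ‖C f‖ ^ 2 ≤ B * ‖f‖ ^ 2) (hε : 0 ≤ ε)
    {h : ℝ[X]} (hh : ∀ t ∈ Set.Icc A B, |t * h.eval t ^ 2 - 1| ≤ ε) (f : E) :
    |‖C (aeval (C.adjoint ∘L C) h f)‖ ^ 2 - ‖f‖ ^ 2| ≤ ε * ‖f‖ ^ 2 := by
  set S := C.adjoint ∘L C
  set T := aeval S h
  have hS : IsSelfAdjoint S := C.isPositive_adjoint_comp_self.isSelfAdjoint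
  have hT : IsSelfAdjoint T := isSelfAdjoint_aeval C h
  -- The norm of the defect is bounded by the supremum of `|t h(t)² - 1|` over the spectrum.
  have h1 : T * S * T - 1 = cfc (X * h ^ 2 - 1 : ℝ[X]).eval S := by
    rw [cfc_polynomial _ _ hS, map_sub, map_mul, aeval_X, map_pow, map_one]
    have : Commute S T := by simpa using (commute_X h).map (aeval S)
    rw [← this.eq, mul_assoc, sq]
  have h2 : ‖T * S * T - 1‖ ≤ ε := by
    rw [h1]
    refine norm_cfc_le hε fun t ht => ?_
    have := hh t (spectrum_adjoint_comp_self_subset C hA hB ht)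
    simpa using this
  have h3 : ‖C (T f)‖ ^ 2 - ‖f‖ ^ 2 = RCLike.re (inner ℂ ((T * S * T - 1) f) f) := by
    rw [sub_apply, inner_sub_left, map_sub, one_apply_eq_self,
      inner_self_eq_norm_sq]
    congr 1
    change _ = RCLike.re (inner ℂ (T (C.adjoint (C (T f)))) f)
    rw [← ContinuousLinearMap.adjoint_inner_right, hT.adjoint_eq,
      ContinuousLinearMap.adjoint_inner_left, inner_self_eq_norm_sq]
  rw [h3]
  refine (RCLike.abs_re_le_norm _).trans ((norm_inner_le_norm _ _).trans ?_)
  rw [sq, ← mul_assoc]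
  gcongr
  exact (ContinuousLinearMap.le_opNorm _ _).trans (by gcongr)

/-- `h(S) C†` is the adjoint of `C h(S)`, so it inherits the norm bound `√(1 + ε)`. -/
theorem norm_sq_aeval_adjoint_le (C : E →L[ℂ] F) {A B ε : ℝ}
    (hA : ∀ f, A * ‖f‖ ^ 2 ≤ ‖C f‖ ^ 2) (hB : ∀ f, ‖C f‖ ^ 2 ≤ B * ‖f‖ ^ 2) (hε : 0 ≤ ε)
    {h : ℝ[X]} (hh : ∀ t ∈ Set.Icc A B, |t * h.eval t ^ 2 - 1| ≤ ε) (v : F) :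
    ‖aeval (C.adjoint ∘L C) h (C.adjoint v)‖ ^ 2 ≤ (1 + ε) * ‖v‖ ^ 2 := by
  set T := aeval (C.adjoint ∘L C) h
  have hT : IsSelfAdjoint T := isSelfAdjoint_aeval C h
  have h1 : ‖C ∘L T‖ ≤ √(1 + ε) := by
    refine ContinuousLinearMap.opNorm_le_bound _ (Real.sqrt_nonneg _) fun f => ?_
    have := (abs_le.1 (abs_norm_sq_aeval_sub_le C hA hB hε hh f)).2
    refine abs_le_of_sq_le_sq' (by
      rw [mul_pow, Real.sq_sqrt (by positivity), ContinuousLinearMap.comp_apply]; linarith)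
      (by positivity) |>.2
  have h2 : T (C.adjoint v) = (C ∘L T).adjoint v := by
    rw [ContinuousLinearMap.adjoint_comp, hT.adjoint_eq]
    rfl
  have h3 : ‖T (C.adjoint v)‖ ≤ √(1 + ε) * ‖v‖ := by
    rw [h2]
    refine (ContinuousLinearMap.le_opNorm _ _).trans ?_
    rw [LinearIsometryEquiv.norm_map]
    gcongr
  calc _ ≤ (√(1 + ε) * ‖v‖) ^ 2 := by gcongr
    _ = _ := by rw [mul_pow, Real.sq_sqrt (by positivity)]

end Spectral

/-! ### Measurable families of operators -/

section Measurability

variable {Z : Type*} [MeasurableSpace Z] {E : Type*} [NormedAddCommGroup E] [InnerProductSpace ℂ E]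
  [SecondCountableTopology E]

/-- A weakly measurable function into a separable Hilbert space is strongly measurable. -/
theorem stronglyMeasurable_of_inner [CompleteSpace E] {g : Z → E}
    (hg : ∀ u : E, Measurable fun z => (inner ℂ u (g z) : ℂ)) : StronglyMeasurable g := by
  let V : ℕ → Submodule ℂ E := fun n => Submodule.span ℂ (denseSeq E '' Set.Iio n)
  have hfin : ∀ n, FiniteDimensional ℂ (V n) := fun n =>
    FiniteDimensional.span_of_finite ℂ ((Set.finite_Iio n).image _)
  have hV : Monotone V := fun i j hij =>
    Submodule.span_mono (Set.image_mono (Set.Iio_subset_Iio hij))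
  have htop : ⊤ ≤ (⨆ n, V n).topologicalClosure := by
    intro x _
    refine closure_mono ?_ (denseRange_denseSeq E x)
    rintro _ ⟨n, rfl⟩
    exact Submodule.mem_iSup_of_mem (n + 1)
      (Submodule.subset_span ⟨n, Nat.lt_succ_self n, rfl⟩)
  refine stronglyMeasurable_of_tendsto (f := fun n z => (V n).starProjection (g z)) Filter.atTop
    (fun n => ?_) (tendsto_pi_nhds.2 fun z => Submodule.starProjection_tendsto_self V hV _ htop)
  let b := stdOrthonormalBasis ℂ (V n)
  have h : ∀ z, (V n).starProjection (g z) = ∑ i, (inner ℂ (b i : E) (g z) : ℂ) • (b i : E) := by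
    intro z
    rw [Submodule.starProjection_apply]
    nth_rw 1 [← b.sum_repr ((V n).orthogonalProjectionOnto (g z))]
    rw [Submodule.coe_sum]
    refine Finset.sum_congr rfl fun i _ => ?_
    rw [Submodule.coe_smul, b.repr_apply_apply, Submodule.inner_orthogonalProjectionOnto_eq_of_mem_left]
  simp_rw [h]
  exact Finset.stronglyMeasurable_fun_sum _ fun i _ =>
    (hg (b i)).stronglyMeasurable.smul_const _

/-- Carathéodory's principle: continuity in the vector and measurability in the parameter give joint
measurability, as `E` is separable. -/
theorem stronglyMeasurable_clm_apply {S : Z → E →L[ℂ] E}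
    (hS : ∀ v, StronglyMeasurable fun z => S z v) {W : Type*} [MeasurableSpace W] {j : W → Z}
    (hj : Measurable j) {g : W → E} (hg : StronglyMeasurable g) :
    StronglyMeasurable fun w => S (j w) (g w) := by
  borelize E
  have := stronglyMeasurable_uncurry_of_continuous_of_stronglyMeasurable
    (u := fun (v : E) (z : Z) => S z v) (fun z => (S z).continuous) hS
  exact this.comp_measurable (hg.measurable.prodMk hj)

open Polynomial in
theorem stronglyMeasurable_aeval {S : Z → E →L[ℂ] E}
    (hS : ∀ v, StronglyMeasurable fun z => S z v) (h : ℝ[X]) (v : E) :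
    StronglyMeasurable fun z => aeval (S z) h v := by
  induction h using Polynomial.induction_on' generalizing v with
  | add p q hp hq =>
    simp_rw [map_add]
    exact (hp v).add (hq v)
  | monomial n a =>
    induction n generalizing v with
    | zero =>
      simp_rw [aeval_monomial, pow_zero]
      exact stronglyMeasurable_const
    | succ n ih =>
      simp_rw [aeval_monomial, pow_succ, ← mul_assoc, ← aeval_monomial]
      have h2 : StronglyMeasurable fun z => aeval (S z) (monomial n a) (S z v) :=
        stronglyMeasurable_clm_apply (S := fun z => aeval (S z) (monomial n a)) ih measurable_id (hS v)
      exact h2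

omit [SecondCountableTopology E] in
open Polynomial in
/-- Intertwining relations pass to polynomials. -/
theorem aeval_intertwine {S S' : E →L[ℂ] E} {U : E →L[ℂ] E} (hU : ∀ v, S' (U v) = U (S v))
    (h : ℝ[X]) (v : E) : aeval S' h (U v) = U (aeval S h v) := by
  induction h using Polynomial.induction_on' generalizing v with
  | add p q hp hq => simp only [map_add, add_apply, hp, hq]
  | monomial n a =>
    induction n generalizing v with
    | zero =>
      simp [Algebra.algebraMap_eq_smul_one]
    | succ n ih =>
      simp only [aeval_monomial, pow_succ, ← mul_assoc]
      simp only [← aeval_monomial, mul_apply_eq_comp, hU, ih]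

end Measurability

/-! ### Mass transport on the hull -/

section MassTransport

variable {G : Type*} [TopologicalSpace G] [Group G] [IsTopologicalGroup G] [T2Space G]
  [LocallyCompactSpace G] [SecondCountableTopology G] [MeasurableSpace G] [BorelSpace G]

/-- The mass transport principle for invariant measures on the punctured hull. -/
theorem mass_transport (m : Measure G) [m.IsHaarMeasure] [m.IsMulRightInvariant] {Λ : Set G}
    (hΛ : IsRelativelySeparated Λ) {μ : Measure (puncturedHull Λ)} [SFinite μ]
    (hμ : ∀ x : G, μ.map (puncturedHullAct x) = μ) {Φ : G × (puncturedHull Λ × G) → ℝ≥0∞}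
    (hΦ : Measurable Φ)
    (hinv : ∀ g x P y, Φ (g * x, puncturedHullAct g P, g * y) = Φ (x, P, y)) {φ : G → ℝ≥0∞}
    (hφ : Measurable φ) :
    (∫⁻ x, φ x ∂m) * ∫⁻ P, ∫⁻ y, Φ (1, P, y) ∂pointMeasure (P : ClosedSubsets G) ∂μ =
      ∫⁻ P, ∫⁻ y, φ y * ∫⁻ x, Φ (x, P, y) ∂m ∂pointMeasure (P : ClosedSubsets G) ∂μ := by
  set κ := pointKernel hΛ
  have hκ : ∀ f : puncturedHull Λ × G → ℝ≥0∞, Measurable f →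
      ∫⁻ P, ∫⁻ y, f (P, y) ∂pointMeasure (P : ClosedSubsets G) ∂μ = ∫⁻ p, f p ∂(μ ⊗ₘ κ) :=
    fun f hf => (Measure.lintegral_compProd (κ := κ) hf).symm
  have hΦ1 : Measurable fun p : puncturedHull Λ × G => Φ (1, p) := hΦ.comp measurable_prodMk_left
  have h1 : Measurable fun q : G × (puncturedHull Λ × G) => φ q.2.2 * Φ q :=
    (hφ.comp (by fun_prop)).mul hΦ
  have h2 : Measurable fun q : G × (puncturedHull Λ × G) => φ (q.1 * q.2.2) * Φ (1, q.2) :=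
    (hφ.comp (by fun_prop)).mul (hΦ1.comp measurable_snd)
  symm
  calc ∫⁻ P, ∫⁻ y, φ y * ∫⁻ x, Φ (x, P, y) ∂m ∂pointMeasure (P : ClosedSubsets G) ∂μ
      = ∫⁻ p, ∫⁻ x, φ p.2 * Φ (x, p) ∂m ∂(μ ⊗ₘ κ) := by
        rw [← hκ _ (Measurable.lintegral_prod_left' h1)]
        refine lintegral_congr fun P => lintegral_congr fun y => ?_
        exact (lintegral_const_mul _ (hΦ.comp measurable_prodMk_right)).symm
    _ = ∫⁻ x, ∫⁻ p, φ p.2 * Φ (x, p) ∂(μ ⊗ₘ κ) ∂m :=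
        lintegral_lintegral_swap (h1.comp measurable_swap).aemeasurable
    -- For fixed `x`, translate `(P, y)` to `(xP, xy)`: the Campbell measure is invariant and `Φ(x,
    -- xP, xy) = Φ(1, P, y)`.
    _ = ∫⁻ x, ∫⁻ p, φ (x * p.2) * Φ (1, p) ∂(μ ⊗ₘ κ) ∂m := by
        refine lintegral_congr fun x => ?_
        have hx : Measurable fun p : puncturedHull Λ × G => φ p.2 * Φ (x, p) :=
          h1.comp measurable_prodMk_left
        have hx' : Measurable fun p : puncturedHull Λ × G => φ (x * p.2) * Φ (1, p) :=
          h2.comp measurable_prodMk_left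
        rw [← hκ _ hx, ← hκ _ hx', ← lintegral_lintegral_pointMeasure_act hΛ hμ hx x]
        refine lintegral_congr fun P => lintegral_congr fun y => ?_
        have := hinv x 1 P y
        rw [mul_one] at this
        dsimp only
        rw [this]
    _ = ∫⁻ p, ∫⁻ x, φ (x * p.2) * Φ (1, p) ∂m ∂(μ ⊗ₘ κ) :=
        lintegral_lintegral_swap h2.aemeasurable
    _ = ∫⁻ p, (∫⁻ x, φ x ∂m) * Φ (1, p) ∂(μ ⊗ₘ κ) := by
        refine lintegral_congr fun p => ?_
        have hp : Measurable fun x => φ (x * p.2) := hφ.comp (measurable_mul_const p.2)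
        -- Unimodularity: `x ↦ xy` preserves the left Haar measure.
        rw [lintegral_mul_const _ hp, lintegral_mul_right_eq_self]
    _ = (∫⁻ x, φ x ∂m) * ∫⁻ p, Φ (1, p) ∂(μ ⊗ₘ κ) := lintegral_const_mul _ hΦ1
    _ = _ := by rw [← hκ _ hΦ1]

end MassTransport

/-! ### Covariance and measurability of frame operators -/

section FrameOperator

open scoped ComplexConjugate

variable {G : Type*} {H : Type*} [NormedAddCommGroup H] [InnerProductSpace ℂ H] [RKHS ℂ H G ℂ]
  [CompleteSpace H]

/-- The frame operator of a set that satisfies a Bessel bound. -/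
noncomputable def frameOperator {P : Set G} {B : ℝ≥0}
    (hB : ∀ f : H, ∑' p : P, ‖f p‖ₑ ^ 2 ≤ B * ‖f‖ₑ ^ 2) : H →L[ℂ] H :=
  (analysisOperator hB).adjoint ∘L analysisOperator hB

theorem inner_frameOperator {P : Set G} {B : ℝ≥0}
    (hB : ∀ f : H, ∑' p : P, ‖f p‖ₑ ^ 2 ≤ B * ‖f‖ₑ ^ 2) (u v : H) :
    inner ℂ u (frameOperator hB v) = ∑' p : P, conj (u p) * v p := by
  rw [frameOperator, ContinuousLinearMap.comp_apply, ContinuousLinearMap.adjoint_inner_right,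
    lp.inner_eq_tsum]
  refine tsum_congr fun p => ?_
  rw [analysisOperator_apply, analysisOperator_apply, RCLike.inner_apply, mul_comm]

omit [CompleteSpace H] in
theorem norm_analysisOperator_sq {P : Set G} {B : ℝ≥0}
    (hB : ∀ f : H, ∑' p : P, ‖f p‖ₑ ^ 2 ≤ B * ‖f‖ₑ ^ 2) (f : H) :
    ‖analysisOperator hB f‖ ^ 2 = (∑' p : P, ‖f p‖ₑ ^ 2).toReal := by
  rw [← enorm_analysisOperator_sq, ENNReal.toReal_pow, toReal_enorm]

omit [CompleteSpace H] in
theorem norm_analysisOperator_sq_le {P : Set G} {B : ℝ≥0}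
    (hB : ∀ f : H, ∑' p : P, ‖f p‖ₑ ^ 2 ≤ B * ‖f‖ₑ ^ 2) (f : H) :
    ‖analysisOperator hB f‖ ^ 2 ≤ B * ‖f‖ ^ 2 := by
  rw [norm_analysisOperator_sq]
  refine ENNReal.toReal_le_of_le_ofReal (by positivity) ((hB f).trans_eq ?_)
  rw [ENNReal.ofReal_mul (by positivity), ENNReal.ofReal_coe_nnreal,
    ENNReal.ofReal_pow (norm_nonneg _), ofReal_norm]

omit [CompleteSpace H] in
theorem le_norm_analysisOperator_sq {P : Set G} {A B : ℝ≥0}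
    (hB : ∀ f : H, ∑' p : P, ‖f p‖ₑ ^ 2 ≤ B * ‖f‖ₑ ^ 2)
    (hA : ∀ f : H, A * ‖f‖ₑ ^ 2 ≤ ∑' p : P, ‖f p‖ₑ ^ 2) (f : H) :
    A * ‖f‖ ^ 2 ≤ ‖analysisOperator hB f‖ ^ 2 := by
  have h := hA f
  rw [← enorm_analysisOperator_sq hB] at h
  have := ENNReal.toReal_mono (by simp) h
  simpa using this

variable [Group G] [TopologicalSpace G] [IsTopologicalGroup G] [MeasurableSpace G] [BorelSpace G]

/-- Paired with `w`, both sides become `∑_{p ∈ P} σ(g, p) · conj(w(gp)) · v(p)`. -/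
theorem frameOperator_translate {m : Measure G} [m.IsMulLeftInvariant] {σ : G → G → Circle}
    (hL2 : IsIsometricallyInL2 H m) (hinv : IsTwistedInvariant H σ) {P : ClosedSubsets G}
    {B : ℝ≥0} (g : G)
    (hB : ∀ f : H, ∑' p : (P : Set G), ‖f p‖ₑ ^ 2 ≤ B * ‖f‖ₑ ^ 2)
    (hB' : ∀ f : H, ∑' p : (translate g P : Set G), ‖f p‖ₑ ^ 2 ≤ B * ‖f‖ₑ ^ 2) (v : H) :
    frameOperator hB' (twistedTranslate hL2 hinv g v) =
      twistedTranslate hL2 hinv g (frameOperator hB v) := by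
  set U := twistedTranslate hL2 hinv g
  refine ext_inner_left ℂ fun w => ?_
  have hU : ∀ p, U.toContinuousLinearMap.adjoint w p = conj (σ g p : ℂ) * w (g * p) := fun p => by
    rw [← inner_kernelVector, ContinuousLinearMap.adjoint_inner_right]
    change inner ℂ (U (kernelVector H p)) w = _
    rw [twistedTranslate_kernelVector, inner_smul_left, inner_kernelVector]
  have h1 : inner ℂ w (U (frameOperator hB v)) =
      inner ℂ (U.toContinuousLinearMap.adjoint w) (frameOperator hB v) :=
    (ContinuousLinearMap.adjoint_inner_left U.toContinuousLinearMap (frameOperator hB v) w).symm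
  rw [h1, inner_frameOperator, inner_frameOperator]
  let e : (P : Set G) ≃ (translate g P : Set G) := translateEquiv g P
  rw [← e.tsum_eq]
  refine tsum_congr fun p => ?_
  rw [hU, map_mul, Complex.conj_conj]
  change conj (w (g * p)) * U v (g * p) = _
  rw [twistedTranslate_apply_mul]
  ring

variable [T2Space G] [LocallyCompactSpace G] [SecondCountableTopology G] {m : Measure G}
  [m.IsHaarMeasure] {σ : G → G → Circle}

include m in
-- The quadratic form at `w` is `∑_{p ∈ P} |w(p)|²`, lower semicontinuous in `P`. Polarization gives
-- weak measurability, and separability makes it strong.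
theorem stronglyMeasurable_frameOperator [SecondCountableTopology H]
    (hσ : Continuous fun p : G × G => σ p.1 p.2)
    (hL2 : IsIsometricallyInL2 H m) (hinv : IsTwistedInvariant H σ) {Λ : Set G} {B : ℝ≥0}
    (hB : ∀ P : puncturedHull Λ, ∀ f : H,
      ∑' p : ((P : ClosedSubsets G) : Set G), ‖f p‖ₑ ^ 2 ≤ B * ‖f‖ₑ ^ 2) (v : H) :
    StronglyMeasurable fun P : puncturedHull Λ => frameOperator (hB P) v := by
  have hw : ∀ w : H, Measurable fun P : puncturedHull Λ =>
      (inner ℂ (frameOperator (hB P) w) w : ℂ) := fun w => by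
    have h1 : ∀ P : puncturedHull Λ, (inner ℂ (frameOperator (hB P) w) w : ℂ) =
        ((∫⁻ y, ‖w y‖ₑ ^ 2 ∂pointMeasure (P : ClosedSubsets G)).toReal : ℂ) := fun P => by
      rw [lintegral_pointMeasure]
      change _ = ((∑' p : ((P : ClosedSubsets G) : Set G), ‖w p‖ₑ ^ 2).toReal : ℂ)
      rw [← norm_analysisOperator_sq (hB P), frameOperator, ContinuousLinearMap.comp_apply,
        ContinuousLinearMap.adjoint_inner_left, inner_self_eq_norm_sq_to_K]
      norm_cast
    simp_rw [h1]
    have h2 : Continuous fun y => ‖w y‖ₑ ^ 2 :=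
      (ENNReal.continuous_pow 2).comp (continuous_coe hσ hL2 hinv w).enorm
    exact Complex.measurable_ofReal.comp
      ((lowerSemicontinuous_lintegral_pointMeasure h2.lowerSemicontinuous).measurable.comp
        measurable_subtype_coe).ennreal_toReal
  refine stronglyMeasurable_of_inner fun u => ?_
  have h3 : ∀ P : puncturedHull Λ, (inner ℂ u (frameOperator (hB P) v) : ℂ) =
      inner ℂ (frameOperator (hB P) u) v := fun P => by
    rw [frameOperator, ContinuousLinearMap.comp_apply, ContinuousLinearMap.comp_apply,
      ContinuousLinearMap.adjoint_inner_left, ContinuousLinearMap.adjoint_inner_right]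
  have h4 : ∀ P : puncturedHull Λ, _ := fun P =>
    inner_map_polarization' (frameOperator (hB P)).toLinearMap u v
  simp only [ContinuousLinearMap.coe_coe] at h4
  simp_rw [h3, h4]
  fun_prop

end FrameOperator

/-! ### The intensity bound -/

section Density

open Polynomial

variable {G : Type*} {H : Type*} [NormedAddCommGroup H] [InnerProductSpace ℂ H] [RKHS ℂ H G ℂ]
  [CompleteSpace H] [Group G] [TopologicalSpace G] [IsTopologicalGroup G] [T2Space G]
  [LocallyCompactSpace G] [SecondCountableTopology G] [MeasurableSpace G] [BorelSpace G]
  {m : Measure G} [m.IsHaarMeasure] [m.IsMulRightInvariant] {σ : G → G → Circle}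

/-- The intensity of an invariant random set of sampling is at least `‖kₑ‖²`, up to `ε`. -/
theorem enorm_kernelVector_sq_mul_lintegral_le (hσ : Continuous fun p : G × G => σ p.1 p.2)
    (hL2 : IsIsometricallyInL2 H m) (hinv : IsTwistedInvariant H σ) {Λ : Set G}
    (hΛ : IsRelativelySeparated Λ) {A B : ℝ≥0} (hA0 : 0 < A)
    (hA : ∀ P : puncturedHull Λ, ∀ f : H,
      A * ‖f‖ₑ ^ 2 ≤ ∑' p : ((P : ClosedSubsets G) : Set G), ‖f p‖ₑ ^ 2)
    (hB : ∀ P : puncturedHull Λ, ∀ f : H,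
      ∑' p : ((P : ClosedSubsets G) : Set G), ‖f p‖ₑ ^ 2 ≤ B * ‖f‖ₑ ^ 2)
    {μ : Measure (puncturedHull Λ)} [IsProbabilityMeasure μ]
    (hμ : ∀ x : G, μ.map (puncturedHullAct x) = μ) {φ : G → ℝ≥0∞} (hφ : Measurable φ)
    {ε : ℝ} (hε : 0 < ε) :
    (∫⁻ x, φ x ∂m) * ENNReal.ofReal ((1 - ε) * ‖kernelVector H (1 : G)‖ ^ 2) ≤
      ENNReal.ofReal (1 + ε) *
        ∫⁻ P, ∫⁻ y, φ y ∂pointMeasure (P : ClosedSubsets G) ∂μ := by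
  classical
  have : Fact ((2 : ℝ≥0∞) ≠ ∞) := ⟨by simp⟩
  have hsep : SecondCountableTopology H :=
    (toL2 hL2).isometry.isEmbedding.secondCountableTopology
  obtain ⟨h, hh⟩ := exists_polynomial_abs_mul_sq_sub_one_le (A := A) (B := B) (by simpa using hA0) hε
  let C := fun P : puncturedHull Λ => analysisOperator (hB P)
  let T : puncturedHull Λ → H →L[ℂ] H := fun P => aeval (frameOperator (hB P)) h
  have hC1 : ∀ P f, (A : ℝ) * ‖f‖ ^ 2 ≤ ‖C P f‖ ^ 2 := fun P =>
    le_norm_analysisOperator_sq (hB P) (hA P)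
  have hC2 : ∀ P f, ‖C P f‖ ^ 2 ≤ (B : ℝ) * ‖f‖ ^ 2 := fun P => norm_analysisOperator_sq_le (hB P)
  have hTsa : ∀ P, IsSelfAdjoint (T P) := fun P => isSelfAdjoint_aeval (C P) h
  have hTm : ∀ v, StronglyMeasurable fun P => T P v := fun v =>
    stronglyMeasurable_aeval (stronglyMeasurable_frameOperator hσ hL2 hinv hB) h v
  have hk : Continuous fun x : G => kernelVector H x := continuous_kernelVector hσ hL2 hinv
  let Φ : G × (puncturedHull Λ × G) → ℝ≥0∞ := fun q =>
    ‖(inner ℂ (kernelVector H q.1) (T q.2.1 (kernelVector H q.2.2)) : ℂ)‖ₑ ^ 2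
  have hΦ : Measurable Φ := by
    have h1 : StronglyMeasurable fun q : G × (puncturedHull Λ × G) =>
        T q.2.1 (kernelVector H q.2.2) :=
      stronglyMeasurable_clm_apply hTm (by fun_prop)
        (hk.stronglyMeasurable.comp_measurable (by fun_prop))
    have h2 : StronglyMeasurable fun q : G × (puncturedHull Λ × G) => kernelVector H q.1 :=
      hk.stronglyMeasurable.comp_measurable measurable_fst
    exact (h2.inner h1).enorm.pow_const 2
  have hcov : ∀ g x P y, Φ (g * x, puncturedHullAct g P, g * y) = Φ (x, P, y) := by
    intro g x P y
    set U := twistedTranslate hL2 hinv g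
    have h1 : T (puncturedHullAct g P) (U (kernelVector H y)) = U (T P (kernelVector H y)) :=
      aeval_intertwine (U := U.toContinuousLinearMap)
        (fun v => frameOperator_translate hL2 hinv g (hB P) (hB (puncturedHullAct g P)) v) h _
    have h2 : inner ℂ (U (kernelVector H x)) (T (puncturedHullAct g P) (U (kernelVector H y))) =
        inner ℂ (kernelVector H x) (T P (kernelVector H y)) := by
      rw [h1, U.inner_map_map]
    have h3 : ∀ z : Circle, ‖(z : ℂ)‖ₑ = 1 := fun z => by
      rw [← ofReal_norm, Circle.norm_coe, ENNReal.ofReal_one]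
    simp only [Φ]
    rw [← h2, twistedTranslate_kernelVector, twistedTranslate_kernelVector, map_smul,
      inner_smul_left, inner_smul_right, enorm_mul, enorm_mul, h3, RCLike.enorm_conj, h3, one_mul,
      one_mul]
  have key := mass_transport m hΛ hμ hΦ hcov hφ
  -- By self-adjointness of `T P` the sum over `y` is `‖C P (T P k_e)‖²`.
  have hleft : ∀ P : puncturedHull Λ, ENNReal.ofReal ((1 - ε) * ‖kernelVector H (1 : G)‖ ^ 2) ≤
      ∫⁻ y, Φ (1, P, y) ∂pointMeasure (P : ClosedSubsets G) := fun P => by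
    have h1 := (abs_le.1 (abs_norm_sq_aeval_sub_le (C P) (hC1 P) (hC2 P) hε.le hh
      (kernelVector H (1 : G)))).1
    have h2 : ∫⁻ y, Φ (1, P, y) ∂pointMeasure (P : ClosedSubsets G) =
        ‖C P (T P (kernelVector H (1 : G)))‖ₑ ^ 2 := by
      rw [enorm_analysisOperator_sq, lintegral_pointMeasure]
      refine tsum_congr fun y => ?_
      simp only [Φ]
      rw [← ContinuousLinearMap.adjoint_inner_left, (hTsa P).adjoint_eq, inner_kernelVector',
        RCLike.enorm_conj]
    rw [h2, ← ofReal_norm, ← ENNReal.ofReal_pow (norm_nonneg _)]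
    refine ENNReal.ofReal_le_ofReal ?_
    change -(ε * ‖kernelVector H (1 : G)‖ ^ 2) ≤
      ‖C P (T P (kernelVector H (1 : G)))‖ ^ 2 - ‖kernelVector H (1 : G)‖ ^ 2 at h1
    linarith
  -- By the isometric inclusion in `L²` the inner integral is `‖T P k_y‖²`, where `k_y` is the
  -- adjoint analysis operator applied to a unit coordinate vector.
  have hright : ∀ P : puncturedHull Λ,
      ∫⁻ y, φ y * ∫⁻ x, Φ (x, P, y) ∂m ∂pointMeasure (P : ClosedSubsets G) ≤
        ENNReal.ofReal (1 + ε) * ∫⁻ y, φ y ∂pointMeasure (P : ClosedSubsets G) := fun P => by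
    rw [lintegral_pointMeasure, lintegral_pointMeasure, ← ENNReal.tsum_mul_left]
    refine ENNReal.tsum_le_tsum fun y => ?_
    rw [mul_comm]
    gcongr
    simp only [Φ, inner_kernelVector]
    rw [lintegral_enorm_sq_eq hL2, ← ofReal_norm, ← ENNReal.ofReal_pow (norm_nonneg _)]
    refine ENNReal.ofReal_le_ofReal ?_
    have h1 := norm_sq_aeval_adjoint_le (C P) (hC1 P) (hC2 P) hε.le hh (lp.single 2 y (1 : ℂ))
    rw [adjoint_analysisOperator_single (hB P) y, lp.norm_single (by norm_num), norm_one, one_pow,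
      mul_one] at h1
    exact h1
  calc (∫⁻ x, φ x ∂m) * ENNReal.ofReal ((1 - ε) * ‖kernelVector H (1 : G)‖ ^ 2)
      = (∫⁻ x, φ x ∂m) * ∫⁻ _P : puncturedHull Λ,
          ENNReal.ofReal ((1 - ε) * ‖kernelVector H (1 : G)‖ ^ 2) ∂μ := by simp
    _ ≤ (∫⁻ x, φ x ∂m) * ∫⁻ P, ∫⁻ y, Φ (1, P, y) ∂pointMeasure (P : ClosedSubsets G) ∂μ := by
        gcongr with P
        exact hleft P
    _ = _ := key
    _ ≤ ∫⁻ P, ENNReal.ofReal (1 + ε) *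
          ∫⁻ y, φ y ∂pointMeasure (P : ClosedSubsets G) ∂μ := lintegral_mono hright
    _ = _ := lintegral_const_mul' _ _ ENNReal.ofReal_ne_top

/-- The total mass of the transverse measure of an invariant random set of sampling is at least
`‖kₑ‖²`. -/
theorem ofReal_norm_kernelVector_sq_le_univ (hσ : Continuous fun p : G × G => σ p.1 p.2)
    (hL2 : IsIsometricallyInL2 H m) (hinv : IsTwistedInvariant H σ) {Λ : Set G}
    (hΛ : IsRelativelySeparated Λ) {A B : ℝ≥0} (hA0 : 0 < A)
    (hA : ∀ P : puncturedHull Λ, ∀ f : H,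
      A * ‖f‖ₑ ^ 2 ≤ ∑' p : ((P : ClosedSubsets G) : Set G), ‖f p‖ₑ ^ 2)
    (hB : ∀ P : puncturedHull Λ, ∀ f : H,
      ∑' p : ((P : ClosedSubsets G) : Set G), ‖f p‖ₑ ^ 2 ≤ B * ‖f‖ₑ ^ 2)
    {μ : Measure (puncturedHull Λ)} [IsProbabilityMeasure μ]
    (hμ : ∀ x : G, μ.map (puncturedHullAct x) = μ) {μ₀ : Measure (transversal Λ)}
    (hμ₀ : IsTransverseMeasure m μ μ₀) :
    ENNReal.ofReal (‖kernelVector H (1 : G)‖ ^ 2) ≤ μ₀ Set.univ := by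
  -- Any bump function works: its integral is positive and finite, so it cancels.
  obtain ⟨ψ, hψc, hψ0, hψ1⟩ := exists_continuous_nonneg_pos (1 : G)
  let φ : G → ℝ≥0 := fun x => (ψ x).toNNReal
  have hφ : Continuous φ := continuous_real_toNNReal.comp ψ.continuous
  have hφc : HasCompactSupport φ := hψc.comp_left Real.toNNReal_zero
  set I := ∫⁻ x, φ x ∂m
  have hI0 : I ≠ 0 := by
    have h1 : Measurable fun x => (φ x : ℝ≥0∞) := hφ.measurable.coe_nnreal_ennreal
    refine ((lintegral_pos_iff_support h1).2 ?_).ne'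
    refine IsOpen.measure_pos m ?_ ⟨1, ?_⟩
    · exact (ENNReal.continuous_coe.comp hφ).isOpen_support
    · have := (hψ0 1).lt_of_ne' hψ1
      simpa [φ] using this
  have hI : I ≠ ∞ := (ψ.continuous.integrable_of_hasCompactSupport hψc).lintegral_lt_top.ne
  rcases eq_or_ne (μ₀ Set.univ) ∞ with htop | htop
  · rw [htop]; exact le_top
  have key : ∀ ε : ℝ, 0 < ε → ENNReal.ofReal ((1 - ε) * ‖kernelVector H (1 : G)‖ ^ 2) ≤
      ENNReal.ofReal (1 + ε) * μ₀ Set.univ := fun ε hε => by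
    have h1 := enorm_kernelVector_sq_mul_lintegral_le hσ hL2 hinv hΛ hA0 hA hB hμ
      hφ.measurable.coe_nnreal_ennreal hε
    rw [← hμ₀.lintegral_mul_univ hφ hφc, mul_left_comm] at h1
    exact (ENNReal.mul_le_mul_iff_right hI0 hI).1 h1
  refine ENNReal.ofReal_le_of_le_toReal ?_
  set D := (μ₀ Set.univ).toReal
  set K := ‖kernelVector H (1 : G)‖ ^ 2
  have hK : 0 ≤ K := by positivity
  have hD : 0 ≤ D := ENNReal.toReal_nonneg
  refine le_of_forall_pos_le_add fun δ hδ => ?_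
  -- The error terms sum to `ε(K + D)`, which this choice of `ε` keeps below `δ`.
  have h2 := key (δ / (K + D + 1)) (by positivity)
  rw [← ENNReal.ofReal_toReal htop, ← ENNReal.ofReal_mul (by positivity),
    ENNReal.ofReal_le_ofReal_iff (by positivity)] at h2
  have h3 : δ / (K + D + 1) * (K + D) ≤ δ := by
    rw [div_mul_eq_mul_div, div_le_iff₀ (by positivity)]
    nlinarith
  change (1 - δ / (K + D + 1)) * K ≤ (1 + δ / (K + D + 1)) * D at h2
  linarith

end Density

end HullDensity

/-! ### The covolume inequality -/

theorem mainTheorem10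
    {G : Type*} [Group G] [TopologicalSpace G] [IsTopologicalGroup G] [T2Space G]
    [LocallyCompactSpace G] [SecondCountableTopology G] [MeasurableSpace G] [BorelSpace G]
    (m : MeasureTheory.Measure G) [m.IsHaarMeasure] [m.IsMulRightInvariant]
    (hIN : HullDensity.IsINGroup G)
    (σ : G → G → Circle) (hσ : HullDensity.IsContinuousTwoCocycle σ)
    (H : Type*) [NormedAddCommGroup H] [InnerProductSpace ℂ H] [CompleteSpace H] [RKHS ℂ H G ℂ]
    (hL2 : HullDensity.IsIsometricallyInL2 H m)
    (hinv : HullDensity.IsTwistedInvariant H σ)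
    (Λ : Set G) (hΛ : HullDensity.IsSetOfSampling H Λ) :
    (Nontrivial H → HullDensity.IsRelativelySeparated Λ) ∧
      ENNReal.ofReal (‖HullDensity.kernelVector H (1 : G)‖ ^ 2) *
        HullDensity.upperCovol m Λ ≤ 1 := by
  open HullDensity in
  obtain ⟨A, B, hA0, hAB⟩ := hΛ.exists_enorm_bounds
  have hA := fun f => (hAB f).1
  have hB := fun f => (hAB f).2
  have hsep : Nontrivial H → IsRelativelySeparated Λ := fun _ =>
    isRelativelySeparated_of_bessel hσ.continuous hL2 hinv hB
  refine ⟨hsep, ?_⟩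
  rcases subsingleton_or_nontrivial H with hH | hH
  · rw [Subsingleton.elim (kernelVector H (1 : G)) 0]
    simp
  have hrel := hsep hH
  obtain ⟨A', hA'0, hA'⟩ := exists_lower_bound_hull hIN hσ.continuous hL2 hinv hrel hA0 hA hB
  simp_rw [upperCovol, ENNReal.mul_iSup]
  refine iSup₂_le fun μ hμ => ?_
  obtain ⟨hμ1, hμinv⟩ := hμ
  have hex := exists_isTransverseMeasure m hrel hμinv
  -- Existence alone is enough: the intensity bound holds for any transverse measure, in particular
  -- the chosen one.
  have htrans : IsTransverseMeasure m μ (transverseMeasure m μ) := by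
    rw [transverseMeasure, dif_pos hex]
    exact hex.choose_spec
  have hBhull : ∀ P : puncturedHull Λ, ∀ f : H,
      ∑' p : ((P : ClosedSubsets G) : Set G), ‖f p‖ₑ ^ 2 ≤ B * ‖f‖ₑ ^ 2 := fun P f => by
    have := bessel_hull hσ.continuous hL2 hinv hrel.isClosed hB P.2.1 f
    rwa [lintegral_pointMeasure] at this
  have h := ofReal_norm_kernelVector_sq_le_univ hσ.continuous hL2 hinv hrel hA'0
    (fun P f => hA' P P.2.1 f) hBhull hμinv htrans
  rw [covol, measure_univ, ← mul_div_assoc, mul_one]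
  exact ENNReal.div_le_of_le_mul (by rwa [one_mul])
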